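/- **Setting.** Let $\varepsilon,\omega,\delta,a_0>0$, let $R,L,K\ge 1$ be integers and put $H=\varepsilon K$, $\Omega=\mathbb R\times(0,H)$, $Y_\varepsilon=(0,\varepsilon)^2$, $W=(0,\varepsilon L)\times(0,\varepsilon K)$, $\Omega_N=(-\varepsilon N,\varepsilon N)\times(0,H)$, $W^+_{R,L}=\varepsilon(R,R+L)\times(0,H)$ and $W^-_{R,L}=\varepsilon(-(R+L),-R)\times(0,H)$. Let $a\in L^\infty(\Omega;\mathbb R)$ with $a\ge a_0$ coincide with $Y_\varepsilon$-periodic functions $a_+$ for $x_1\ge \varepsilon R/2$ and $a_-$ for $x_1\le-\varepsilon R/2$. For $u:\Omega_{R+L}\to\mathbb C$ let $\{u\}^+_{R,L}(x)=u(\varepsilon R+x_1,x_2)$ and $\{u\}^-_{R,L}(x)=u(-\varepsilon(R+L)+x_1,x_2)$ for $x\in W$. **Bloch waves.** For $j\in[0,1]^2$ let $(\Psi^\pm_{j,m})_{m\in\mathbb N_0}$ be an $L^2(Y_\varepsilon)$-orthogonal family of eigenfunctions in $H^1_\sharp(Y_\varepsilon;\mathbb C)$ of $\mathcal L^\pm_j=-(\nabla+2\pi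 i j/\varepsilon)\cdot(a_\pm(\nabla+2\pi i j/\varepsilon))$ with nondecreasing eigenvalues, normalized by $|Y_\varepsilon|^{-1}\int_{Y_\varepsilon}|\Psi^\pm_{j,m}|^2=1$. Let $Q_K=\{0,\frac1K,\dots,\frac{K-1}K\}$, $I_{L,K}=\{\lambda=(j,m): j\in Q_L\times Q_K,\ m\in\mathbb N_0\}$, $U^\pm_\lambda(x)=\Psi^\pm_\lambda(x)e^{2\pi i j\cdot x/\varepsilon}$, $$b^\pm(u,v)=\frac1{|W|}\int_W\bar u\,e_1\cdot[a_\pm\nabla v],\qquad P^\pm_\lambda=\operatorname{Im}\frac1{|Y_\varepsilon|}\int_{Y_\varepsilon}\bar U^\pm_\lambda\,e_1\cdot[a_\pm\nabla U^\pm_\lambda].$$ For index sets $I^\pm\subset I_{L,K}$ let $X^\pm=\operatorname{span}\{U^\pm_\lambda:\lambda\in I^\pm\}$ (functions on $W$) and $$V=\{u\in H^1(\Omega_{R+L}): u\text{ vertically periodic},\ \{u\}^+_{R,L}\in X^+,\ \{u\}^-_{R,L}\in X^-\}.$$ **The form.** Let $\vartheta(x)=1$ for $|x_1|\le\varepsilon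 R$, $\vartheta(x)=0$ for $|x_1|\ge\varepsilon(R+L)$ and $\vartheta(x)=(\varepsilon(R+L)-|x_1|)/(\varepsilon L)$ otherwise, and $$\beta(u,v)=\int_{\Omega_{R+L}}a\nabla\bar u\cdot\nabla v\,\vartheta-\int_{\Omega_{R+L}}(1-i\delta\mathbf 1_{\Omega_R})\omega^2\bar u v\,\vartheta-\frac1{\varepsilon L}\int_{W^+_{R,L}}a\nabla\bar u\cdot e_1\,v+\frac1{\varepsilon L}\int_{W^-_{R,L}}a\nabla\bar u\cdot e_1\,v.$$ **Assumptions**, with constants $c_0,C_0>0$ and for both signs: - (A1) $\pm P^\pm_\lambda\ge c_0$ for every $\lambda\in I_{L,K}$ with $U^\pm_\lambda\in X^\pm$; - (A2) any two distinct indices $(j,m),(\tilde j,\tilde m)\in I^\pm$ satisfy $j\ne\tilde j$; - (A3) $\|u\|^2_{H^1(W)}\le C_0\|u\|^2_{L^2(W)}$ for every $u\in X^\pm$. **Proposition ($H^1(\Omega_{R+L})$-coercivity).** Assume (A1)–(A3) and let $\sigma>0$ satisfy $$\sigma\le\min\Big\{\frac12,\frac{c_0}{4\varepsilon L\delta\omega^2}\Big\},\qquad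 2\sigma\delta\,|\operatorname{Re}b^\pm(U^\pm_\lambda,U^\pm_\lambda)|\le\pm\operatorname{Im}b^\pm(U^\pm_\lambda,U^\pm_\lambda)\quad\text{for all }\lambda\in I_{L,K}\text{ with }U^\pm_\lambda\in X^\pm.$$ Then there is $\gamma>0$, depending only on $c_0,C_0,\delta,\sigma,\omega,a_0,\varepsilon,L$, such that $$\operatorname{Im}\beta(u,u)+\sigma\delta\operatorname{Re}\beta(u,u)\ \ge\ \gamma\,\|u\|^2_{H^1(\Omega_{R+L})}\qquad\text{for all }u\in V.$$ -/

import Mathlib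

open MeasureTheory Set
open scoped ComplexConjugate

noncomputable section

namespace Waveguide

/-! ### Weak gradients and `H¹` -/

/-- `g = (g₁, g₂)` is a weak gradient of `u` on the open set `S ⊆ ℝ²`. -/
def HasWeakGradOn (S : Set (ℝ × ℝ)) (u : ℝ × ℝ → ℂ) (g : ℝ × ℝ → ℂ × ℂ) : Prop :=
  LocallyIntegrableOn u S volume ∧ LocallyIntegrableOn g S volume ∧
    ∀ φ : ℝ × ℝ → ℝ, ContDiff ℝ (⊤ : ℕ∞) φ → HasCompactSupport φ → tsupport φ ⊆ S →
      (∫ x in S, u x * (fderiv ℝ φ x (1, 0) : ℂ) = -∫ x in S, (g x).1 * (φ x : ℂ)) ∧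
      (∫ x in S, u x * (fderiv ℝ φ x (0, 1) : ℂ) = -∫ x in S, (g x).2 * (φ x : ℂ))

open Classical in
/-- The weak gradient of `u` on `S` (determined almost everywhere on `S` when it exists;
the value `0` is used for functions that are not weakly differentiable). -/
def weakGrad (S : Set (ℝ × ℝ)) (u : ℝ × ℝ → ℂ) : ℝ × ℝ → ℂ × ℂ :=
  if h : ∃ g, HasWeakGradOn S u g then Classical.choose h else 0

/-- `u` is weakly differentiable on `S`, and `u` and its weak gradient are square integrable on
`B ⊆ S`. For `B = S` this is `u ∈ H¹(S)`. For functions with periodicity conditions, `S` is the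
periodically extended domain and `B` is one period of it. -/
def MemH1 (S B : Set (ℝ × ℝ)) (u : ℝ × ℝ → ℂ) : Prop :=
  MemLp u 2 (volume.restrict B) ∧
    ∃ g, HasWeakGradOn S u g ∧ MemLp g 2 (volume.restrict B)

/-- `‖u‖²` in `L²(B)`. -/
def l2NormSq (B : Set (ℝ × ℝ)) (u : ℝ × ℝ → ℂ) : ℝ :=
  ∫ x in B, ‖u x‖ ^ 2

/-- `‖u‖²` in `H¹(B)`, the weak gradient being taken on `S ⊇ B`. -/
def h1NormSq (S B : Set (ℝ × ℝ)) (u : ℝ × ℝ → ℂ) : ℝ :=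
  l2NormSq B u + ∫ x in B, (‖(weakGrad S u x).1‖ ^ 2 + ‖(weakGrad S u x).2‖ ^ 2)

/-! ### Geometry -/

/-- The periodicity cell `Y_ε = (0, ε)²`. -/
def cell (ε : ℝ) : Set (ℝ × ℝ) := Ioo 0 ε ×ˢ Ioo 0 ε

/-- The infinite waveguide `Ω = ℝ × (0, H)` with `H = εK`. -/
def guide (ε : ℝ) (K : ℕ) : Set (ℝ × ℝ) := univ ×ˢ Ioo 0 (ε * K)

/-- The truncated guide `Ω_N = (-εN, εN) × (0, εK)`. -/
def trunc (ε : ℝ) (N K : ℕ) : Set (ℝ × ℝ) := Ioo (-(ε * N)) (ε * N) ×ˢ Ioo 0 (ε * K)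

/-- The truncated guide, unrolled vertically: `(-εN, εN) × ℝ`. -/
def unrolled (ε : ℝ) (N : ℕ) : Set (ℝ × ℝ) := Ioo (-(ε * N)) (ε * N) ×ˢ univ

/-- The box `W = (0, εL) × (0, εK)`. -/
def box (ε : ℝ) (L K : ℕ) : Set (ℝ × ℝ) := Ioo 0 (ε * L) ×ˢ Ioo 0 (ε * K)

/-- The right radiation box `W⁺_{R,L}`. -/
def boxRight (ε : ℝ) (R L K : ℕ) : Set (ℝ × ℝ) :=
  Ioo (ε * R) (ε * (R + L)) ×ˢ Ioo 0 (ε * K)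

/-- The left radiation box `W⁻_{R,L}`. -/
def boxLeft (ε : ℝ) (R L K : ℕ) : Set (ℝ × ℝ) :=
  Ioo (-(ε * (R + L))) (-(ε * R)) ×ˢ Ioo 0 (ε * K)

/-- `{u}⁺_{R,L}`: the restriction to the right box, shifted to the origin. -/
def shiftRight (ε : ℝ) (R : ℕ) (u : ℝ × ℝ → ℂ) : ℝ × ℝ → ℂ :=
  fun x => u (ε * R + x.1, x.2)

/-- `{u}⁻_{R,L}`: the restriction to the left box, shifted to the origin. -/
def shiftLeft (ε : ℝ) (R L : ℕ) (u : ℝ × ℝ → ℂ) : ℝ × ℝ → ℂ :=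
  fun x => u (-(ε * (R + L)) + x.1, x.2)

/-- `f` is `ε`-periodic in both variables. -/
def CellPeriodic {E : Type*} (ε : ℝ) (f : ℝ × ℝ → E) : Prop :=
  ∀ x : ℝ × ℝ, f (x.1 + ε, x.2) = f x ∧ f (x.1, x.2 + ε) = f x

/-- The medium: `a ∈ L^∞(Ω; ℝ)`, `a ≥ a₀`, and `a` equals the `Y_ε`-periodic functions `a₊` for
`x₁ ≥ εR/2` and `a₋` for `x₁ ≤ -εR/2`. -/
structure IsMedium (ε : ℝ) (R K : ℕ) (a₀ : ℝ) (a ap am : ℝ × ℝ → ℝ) : Prop where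
  measurable : AEStronglyMeasurable a (volume.restrict (guide ε K))
  bounded : ∃ M : ℝ, ∀ᵐ x ∂volume.restrict (guide ε K), a x ≤ M
  lower : ∀ᵐ x ∂volume.restrict (guide ε K), a₀ ≤ a x
  periodic_right : CellPeriodic ε ap
  periodic_left : CellPeriodic ε am
  eq_right : ∀ᵐ x ∂volume.restrict (guide ε K), ε * R / 2 ≤ x.1 → a x = ap x
  eq_left : ∀ᵐ x ∂volume.restrict (guide ε K), x.1 ≤ -(ε * R / 2) → a x = am x

/-! ### Bloch waves -/

/-- The shifted gradient `(∇ + 2πi j/ε) ψ` of a function on `ℝ²`. -/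
def blochGrad (ε : ℝ) (j : ℝ × ℝ) (ψ : ℝ × ℝ → ℂ) (x : ℝ × ℝ) : ℂ × ℂ :=
  ((weakGrad univ ψ x).1 + 2 * Real.pi * Complex.I * (j.1 / ε : ℝ) * ψ x,
   (weakGrad univ ψ x).2 + 2 * Real.pi * Complex.I * (j.2 / ε : ℝ) * ψ x)

/-- `ψ ∈ H¹_♯(Y_ε; ℂ)`, regarded as a periodic function on `ℝ²`. -/
def MemH1Per (ε : ℝ) (ψ : ℝ × ℝ → ℂ) : Prop :=
  CellPeriodic ε ψ ∧ MemH1 univ (cell ε) ψ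

/-- `ψ ∈ H¹_♯(Y_ε)` satisfies `𝓛_j ψ = μ ψ` (weakly), where
`𝓛_j = -(∇ + 2πi j/ε) · (a (∇ + 2πi j/ε))` with periodic boundary conditions. -/
def IsBlochEigen (ε : ℝ) (a : ℝ × ℝ → ℝ) (j : ℝ × ℝ) (μ : ℝ) (ψ : ℝ × ℝ → ℂ) : Prop :=
  MemH1Per ε ψ ∧ ∀ φ : ℝ × ℝ → ℂ, MemH1Per ε φ →
    ∫ x in cell ε, (a x : ℂ) * ((blochGrad ε j ψ x).1 * conj (blochGrad ε j φ x).1 +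
        (blochGrad ε j ψ x).2 * conj (blochGrad ε j φ x).2) =
      (μ : ℂ) * ∫ x in cell ε, ψ x * conj (φ x)

/-- For every `j ∈ [0,1]²`, `(Ψ j m)_{m ∈ ℕ}` is an orthogonal family of eigenfunctions of `𝓛_j`
with nondecreasing eigenvalues `μ j m`, normalized in mean square over `Y_ε`. -/
structure IsBlochFamily (ε : ℝ) (a : ℝ × ℝ → ℝ) (Ψ : ℝ × ℝ → ℕ → ℝ × ℝ → ℂ)
    (μ : ℝ × ℝ → ℕ → ℝ) : Prop where
  eigen : ∀ j ∈ Icc (0 : ℝ) 1 ×ˢ Icc (0 : ℝ) 1, ∀ m, IsBlochEigen ε a j (μ j m) (Ψ j m)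
  mono : ∀ j ∈ Icc (0 : ℝ) 1 ×ˢ Icc (0 : ℝ) 1, ∀ m, μ j m ≤ μ j (m + 1)
  orthogonal : ∀ j ∈ Icc (0 : ℝ) 1 ×ˢ Icc (0 : ℝ) 1, ∀ m n, m ≠ n →
    ∫ x in cell ε, conj (Ψ j m x) * Ψ j n x = 0
  normalized : ∀ j ∈ Icc (0 : ℝ) 1 ×ˢ Icc (0 : ℝ) 1, ∀ m,
    ⨍ x in cell ε, ‖Ψ j m x‖ ^ 2 = 1

/-- `Q_K = {0, 1/K, …, (K-1)/K}`. -/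
def gridQ (K : ℕ) : Set ℝ := {q | ∃ k : ℕ, k < K ∧ q = k / K}

/-- The index set `I_{L,K}` of pairs `λ = (j, m)` with `j ∈ Q_L × Q_K`. -/
def indexSet (L K : ℕ) : Set ((ℝ × ℝ) × ℕ) := {l | l.1.1 ∈ gridQ L ∧ l.1.2 ∈ gridQ K}

/-- The Bloch wave `U_λ(x) = Ψ_λ(x) exp(2πi j·x/ε)`, `λ = (j, m)`. -/
def blochWave (ε : ℝ) (Ψ : ℝ × ℝ → ℕ → ℝ × ℝ → ℂ) (l : (ℝ × ℝ) × ℕ) : ℝ × ℝ → ℂ :=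
  fun x => Ψ l.1 l.2 x *
    Complex.exp (2 * Real.pi * Complex.I * ((l.1.1 * x.1 + l.1.2 * x.2) / ε : ℝ))

/-- The mean energy flux `⨍_B ū e₁ · [a ∇v]` over the open set `B`. For `B = W` and `a = a_±` this
is `b^±(u, v)`. -/
def energyFlux (a : ℝ × ℝ → ℝ) (B : Set (ℝ × ℝ)) (u v : ℝ × ℝ → ℂ) : ℂ :=
  ⨍ x in B, conj (u x) * ((a x : ℂ) * (weakGrad B v x).1)

/-- The Poynting number `P_λ = Im ⨍_{Y_ε} Ū_λ e₁ · [a ∇U_λ]`. -/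
def poynting (ε : ℝ) (a : ℝ × ℝ → ℝ) (Ψ : ℝ × ℝ → ℕ → ℝ × ℝ → ℂ) (l : (ℝ × ℝ) × ℕ) : ℝ :=
  (energyFlux a (cell ε) (blochWave ε Ψ l) (blochWave ε Ψ l)).im

/-- `X = span {U_λ | λ ∈ I}`, as functions on `W = (0, εL) × (0, εK)` up to null sets. -/
def blochSpan (ε : ℝ) (L K : ℕ) (Ψ : ℝ × ℝ → ℕ → ℝ × ℝ → ℂ) (I : Set ((ℝ × ℝ) × ℕ)) :
    Set (ℝ × ℝ → ℂ) :=
  {w | ∃ w' ∈ Submodule.span ℂ (blochWave ε Ψ '' I), w =ᵐ[volume.restrict (box ε L K)] w'}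

/-! ### The truncated problem -/

/-- The space `V`: functions `u ∈ H¹(Ω_{R+L})`, vertically periodic with period `εK`, such that
`{u}^± ∈ X^±`. A function on the vertically periodic domain is regarded as an `εK`-periodic
function of `x₂ ∈ ℝ`. -/
def spaceV (ε : ℝ) (R L K : ℕ) (Xp Xm : Set (ℝ × ℝ → ℂ)) : Set (ℝ × ℝ → ℂ) :=
  {u | (∀ x : ℝ × ℝ, u (x.1, x.2 + ε * K) = u x) ∧
    MemH1 (unrolled ε (R + L)) (trunc ε (R + L) K) u ∧
    shiftRight ε R u ∈ Xp ∧ shiftLeft ε R L u ∈ Xm}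

/-- The cut-off function `ϑ`. -/
def cutoff (ε : ℝ) (R L : ℕ) (ξ : ℝ) : ℝ :=
  if ε * (R + L) ≤ |ξ| then 0
  else if |ξ| ≤ ε * R then 1
  else (ε * (R + L) - |ξ|) / (ε * L)

open Classical in
/-- The sesquilinear form `β` of the truncated problem. -/
def beta (ε ω δ : ℝ) (R L K : ℕ) (a : ℝ × ℝ → ℝ) (u v : ℝ × ℝ → ℂ) : ℂ :=
  let Du := weakGrad (unrolled ε (R + L)) u
  let Dv := weakGrad (unrolled ε (R + L)) v
  (∫ x in trunc ε (R + L) K,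
      (a x : ℂ) * (conj (Du x).1 * (Dv x).1 + conj (Du x).2 * (Dv x).2) * (cutoff ε R L x.1 : ℂ))
    - (∫ x in trunc ε (R + L) K,
      (1 - Complex.I * δ * (if x ∈ trunc ε R K then 1 else 0)) * (ω : ℂ) ^ 2 *
        conj (u x) * v x * (cutoff ε R L x.1 : ℂ))
    - 1 / ((ε : ℂ) * L) * (∫ x in boxRight ε R L K, (a x : ℂ) * conj (Du x).1 * v x)
    + 1 / ((ε : ℂ) * L) * (∫ x in boxLeft ε R L K, (a x : ℂ) * conj (Du x).1 * v x)

end Waveguide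

end

open Waveguide

noncomputable section

namespace Waveguide

/-! ### Weak derivatives -/

/-! Put `τ = σδ`, `κ = 1/(εL)` and `J_± = ∫ ū a ∂₁u` over the right and left radiation boxes. On the
diagonal the form splits explicitly (`beta_self_eq`): the imaginary part is `δω²‖u‖²` on `Ω_R` plus
`κ (Im J_+ - Im J_-)`, with no gradient term; the real part has the weighted Dirichlet energy, minus
`ω²` times the weighted mass, minus `κ (Re J_+ - Re J_-)`. Adding `τ Re β` therefore gains the
gradient on `Ω_R`, at the cost of some mass everywhere and of the real parts of the fluxes.

The fluxes are controlled by diagonalization (`exists_diagonal_expansion`). Bloch waves and their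
gradients pick up the phases `exp(2πi j₁)`, `exp(2πi j₂)` under a shift by one cell, so an integral
over the box is the integral over a cell times two geometric sums. For distinct grid wave numbers
one of these is a vanishing sum of roots of unity; for equal ones the integrand is periodic and the
box average is the cell average. With distinct wave numbers in the index set, both the mass and the
flux become sums over modes with the same weights `|α_λ|²`. Modewise, smallness of `σ` gives `±(Im b
- τ Re b) ≥ ±Im b / 2 ≥ c₀/2` (`half_mul_average_le_flux`), and translation by whole periods carries
this to the actual boxes (`flux_and_regularity_of_shift`).

Thus each box contributes `κc₀/2 = 2q` times its mass, where `q = c₀/(4εL)`. One `q` absorbs the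
loss `τω²`; the other pays for the full `H¹` norm there through (A3). On `Ω_R`, `σ ≤ 1/2` leaves
half of the absorption `δω²`, and the gradient comes from `τ a₀`, since `ϑ = 1` there. -/

/-- `h` is the weak derivative of `u` on `S` in the direction `v`. -/
def HasWeakDerivOn (S : Set (ℝ × ℝ)) (v : ℝ × ℝ) (u h : ℝ × ℝ → ℂ) : Prop :=
  LocallyIntegrableOn u S volume ∧ LocallyIntegrableOn h S volume ∧
    ∀ φ : ℝ × ℝ → ℝ, ContDiff ℝ (⊤ : ℕ∞) φ → HasCompactSupport φ → tsupport φ ⊆ S →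
      ∫ x in S, u x * (fderiv ℝ φ x v : ℂ) = -∫ x in S, h x * (φ x : ℂ)

variable {S S' : Set (ℝ × ℝ)} {v : ℝ × ℝ} {u u' h h' : ℝ × ℝ → ℂ} {g g' : ℝ × ℝ → ℂ × ℂ}

theorem hasWeakGradOn_iff :
    HasWeakGradOn S u g ↔ HasWeakDerivOn S (1, 0) u (fun x => (g x).1) ∧
      HasWeakDerivOn S (0, 1) u (fun x => (g x).2) := by
  constructor
  · rintro ⟨hu, hg, H⟩
    refine ⟨⟨hu, fun x hx => ?_, fun φ h1 h2 h3 => (H φ h1 h2 h3).1⟩,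
      ⟨hu, fun x hx => ?_, fun φ h1 h2 h3 => (H φ h1 h2 h3).2⟩⟩
    · obtain ⟨s, hs, hi⟩ := hg x hx
      exact ⟨s, hs, hi.fst⟩
    · obtain ⟨s, hs, hi⟩ := hg x hx
      exact ⟨s, hs, hi.snd⟩
  · rintro ⟨⟨hu, hg1, H1⟩, ⟨-, hg2, H2⟩⟩
    refine ⟨hu, fun x hx => ?_, fun φ h1 h2 h3 => ⟨H1 φ h1 h2 h3, H2 φ h1 h2 h3⟩⟩
    obtain ⟨s, hs, hi⟩ := hg1 x hx
    obtain ⟨t, ht, hj⟩ := hg2 x hx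
    exact ⟨s ∩ t, Filter.inter_mem hs ht,
      (hi.mono_set inter_subset_left).prodMk (hj.mono_set inter_subset_right)⟩

theorem integrable_mul_of_locallyIntegrableOn {χ : ℝ × ℝ → ℂ} (hu : LocallyIntegrableOn u S volume)
    (hχ : Continuous χ) (hc : HasCompactSupport χ) (hs : tsupport χ ⊆ S) :
    Integrable fun x => u x * χ x := by
  have h1 : IntegrableOn (fun x => u x * χ x) (tsupport χ) volume :=
    (hu.integrableOn_compact_subset hs hc).mul_continuousOn hχ.continuousOn hc
  refine (integrableOn_iff_integrable_of_support_subset ?_).1 h1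
  intro x hx
  refine subset_tsupport _ ?_
  intro h0
  exact hx (by simp [h0])

/-- Removing the domain from the integral allows weak derivatives on nested sets to be compared. -/
theorem setIntegral_mul_of_tsupport_subset {χ : ℝ × ℝ → ℂ} (hs : tsupport χ ⊆ S) :
    ∫ x in S, u x * χ x = ∫ x, u x * χ x :=
  setIntegral_eq_integral_of_forall_compl_eq_zero fun x hx => by
    rw [image_eq_zero_of_notMem_tsupport fun h => hx (hs h), mul_zero]

section TestFunction

variable {φ : ℝ × ℝ → ℝ}

theorem tsupport_ofReal_subset : tsupport (fun x => (φ x : ℂ)) ⊆ tsupport φ :=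
  closure_mono fun x hx h0 => hx (by simp [h0])

theorem tsupport_ofReal_fderiv_subset : tsupport (fun x => (fderiv ℝ φ x v : ℂ)) ⊆ tsupport φ := by
  refine closure_minimal (fun x hx => ?_) (isClosed_tsupport φ)
  by_contra h0
  refine hx ?_
  have := image_eq_zero_of_notMem_tsupport (f := fderiv ℝ φ) (x := x)
    (fun h => h0 (tsupport_fderiv_subset ℝ h))
  simp [this]

theorem integrable_mul_test (hu : LocallyIntegrableOn u S volume) (h1 : Continuous φ)
    (h2 : HasCompactSupport φ) (h3 : tsupport φ ⊆ S) : Integrable fun x => u x * (φ x : ℂ) :=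
  integrable_mul_of_locallyIntegrableOn hu (by fun_prop)
    (h2.of_isClosed_subset (isClosed_tsupport _) tsupport_ofReal_subset)
    (tsupport_ofReal_subset.trans h3)

theorem integrable_mul_fderiv_test (hu : LocallyIntegrableOn u S volume)
    (h1 : ContDiff ℝ (⊤ : ℕ∞) φ) (h2 : HasCompactSupport φ) (h3 : tsupport φ ⊆ S) :
    Integrable fun x => u x * (fderiv ℝ φ x v : ℂ) := by
  have hc : Continuous fun x => fderiv ℝ φ x v :=
    (h1.continuous_fderiv (by simp)).clm_apply continuous_const
  exact integrable_mul_of_locallyIntegrableOn hu (by fun_prop)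
    (h2.of_isClosed_subset (isClosed_tsupport _) tsupport_ofReal_fderiv_subset)
    (tsupport_ofReal_fderiv_subset.trans h3)

end TestFunction

namespace HasWeakDerivOn

theorem mono (H : HasWeakDerivOn S v u h) (hS : S' ⊆ S) : HasWeakDerivOn S' v u h := by
  refine ⟨H.1.mono_set hS, H.2.1.mono_set hS, fun φ h1 h2 h3 => ?_⟩
  have := H.2.2 φ h1 h2 (h3.trans hS)
  rwa [setIntegral_mul_of_tsupport_subset (tsupport_ofReal_fderiv_subset.trans (h3.trans hS)),
    setIntegral_mul_of_tsupport_subset (tsupport_ofReal_subset.trans (h3.trans hS)),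
    ← setIntegral_mul_of_tsupport_subset (tsupport_ofReal_fderiv_subset.trans h3),
    ← setIntegral_mul_of_tsupport_subset (tsupport_ofReal_subset.trans h3)] at this

theorem ae_unique (hS : IsOpen S) (H : HasWeakDerivOn S v u h) (H' : HasWeakDerivOn S v u h') :
    h =ᵐ[volume.restrict S] h' := by
  -- The fundamental lemma of the calculus of variations, applied to the difference of the two
  -- derivatives.
  have key : ∀ᵐ x ∂(volume : Measure (ℝ × ℝ)), x ∈ S → (h - h') x = 0 := by
    refine hS.ae_eq_zero_of_integral_contDiff_smul_eq_zero (H.2.1.sub H'.2.1) fun φ h1 h2 h3 => ?_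
    have e1 := H.2.2 φ h1 h2 h3
    rw [H'.2.2 φ h1 h2 h3, neg_inj,
      setIntegral_mul_of_tsupport_subset (tsupport_ofReal_subset.trans h3),
      setIntegral_mul_of_tsupport_subset (tsupport_ofReal_subset.trans h3)] at e1
    have : ∀ x, φ x • (h - h') x = h x * (φ x : ℂ) - h' x * (φ x : ℂ) := fun x => by
      simp only [Pi.sub_apply, Complex.real_smul]; ring
    simp_rw [this]
    rw [integral_sub (integrable_mul_test H.2.1 h1.continuous h2 h3)
      (integrable_mul_test H'.2.1 h1.continuous h2 h3), e1, sub_self]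
  refine (ae_restrict_iff' hS.measurableSet).2 ?_
  filter_upwards [key] with x hx hxS
  exact sub_eq_zero.1 (hx hxS)

theorem congr_ae (H : HasWeakDerivOn S v u h) (hu : u =ᵐ[volume.restrict S] u') :
    HasWeakDerivOn S v u' h := by
  refine ⟨fun x hx => ?_, H.2.1, fun φ h1 h2 h3 => ?_⟩
  · obtain ⟨s, hs, hi⟩ := H.1 x hx
    have : s ∩ S ∈ nhdsWithin x S := Filter.inter_mem hs self_mem_nhdsWithin
    refine ⟨s ∩ S, this, ?_⟩
    exact (hi.mono_set inter_subset_left).congr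
      (ae_mono (Measure.restrict_mono inter_subset_right le_rfl) hu)
  · rw [← H.2.2 φ h1 h2 h3]
    refine integral_congr_ae ?_
    filter_upwards [hu] with x hx
    rw [hx]

theorem const_mul (H : HasWeakDerivOn S v u h) (c : ℂ) :
    HasWeakDerivOn S v (fun x => c * u x) (fun x => c * h x) := by
  refine ⟨fun x hx => ?_, fun x hx => ?_, fun φ h1 h2 h3 => ?_⟩
  · obtain ⟨s, hs, hi⟩ := H.1 x hx
    exact ⟨s, hs, hi.const_mul c⟩
  · obtain ⟨s, hs, hi⟩ := H.2.1 x hx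
    exact ⟨s, hs, hi.const_mul c⟩
  · simp_rw [mul_assoc, integral_const_mul]
    rw [H.2.2 φ h1 h2 h3, mul_neg]

theorem add (H : HasWeakDerivOn S v u h) (H' : HasWeakDerivOn S v u' h') :
    HasWeakDerivOn S v (fun x => u x + u' x) (fun x => h x + h' x) := by
  refine ⟨H.1.add H'.1, H.2.1.add H'.2.1, fun φ h1 h2 h3 => ?_⟩
  simp_rw [add_mul]
  rw [integral_add (integrable_mul_fderiv_test H.1 h1 h2 h3).integrableOn
      (integrable_mul_fderiv_test H'.1 h1 h2 h3).integrableOn,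
    integral_add (integrable_mul_test H.2.1 h1.continuous h2 h3).integrableOn
      (integrable_mul_test H'.2.1 h1.continuous h2 h3).integrableOn,
    H.2.2 φ h1 h2 h3, H'.2.2 φ h1 h2 h3, neg_add]

theorem sum {ι : Type*} (F : Finset ι) {u h : ι → ℝ × ℝ → ℂ}
    (H : ∀ i ∈ F, HasWeakDerivOn S v (u i) (h i)) :
    HasWeakDerivOn S v (fun x => ∑ i ∈ F, u i x) (fun x => ∑ i ∈ F, h i x) := by
  classical
  induction F using Finset.induction_on with
  | empty =>
    have h0 : LocallyIntegrableOn (fun _ : ℝ × ℝ => (0 : ℂ)) S volume :=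
      (locallyIntegrable_const 0).locallyIntegrableOn S
    simpa using ⟨h0, h0, fun φ _ _ _ => by simp⟩
  | insert i F hi ih =>
    simp_rw [Finset.sum_insert hi]
    exact (H i (Finset.mem_insert_self i F)).add
      (ih fun j hj => H j (Finset.mem_insert_of_mem hj))

/-- The product `p φ` is again a test function; inserting it and expanding its derivative gives the
Leibniz rule. -/
theorem mul_real (hS : IsOpen S) (H : HasWeakDerivOn S v u h) {p : ℝ × ℝ → ℝ}
    (hp : ContDiff ℝ (⊤ : ℕ∞) p) :
    HasWeakDerivOn S v (fun x => u x * (p x : ℂ))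
      (fun x => h x * (p x : ℂ) + u x * (fderiv ℝ p x v : ℂ)) := by
  have hpc : Continuous fun x => fderiv ℝ p x v :=
    (hp.continuous_fderiv (by simp)).clm_apply continuous_const
  have hp0 := hp.continuous
  have l1 : LocallyIntegrableOn (fun x => u x * (p x : ℂ)) S volume :=
    H.1.mul_continuousOn (by fun_prop) hS.isLocallyClosed
  have l2 : LocallyIntegrableOn (fun x => h x * (p x : ℂ)) S volume :=
    H.2.1.mul_continuousOn (by fun_prop) hS.isLocallyClosed
  have l3 : LocallyIntegrableOn (fun x => u x * (fderiv ℝ p x v : ℂ)) S volume :=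
    H.1.mul_continuousOn (by fun_prop) hS.isLocallyClosed
  refine ⟨l1, l2.add l3, fun φ h1 h2 h3 => ?_⟩
  have e := H.2.2 (fun x => p x * φ x) (hp.mul h1) h2.mul_left
    ((tsupport_mul_subset_right).trans h3)
  have hd : ∀ x, fderiv ℝ (fun x => p x * φ x) x v = p x * fderiv ℝ φ x v + φ x * fderiv ℝ p x v := by
    intro x
    rw [fderiv_fun_mul (hp.differentiable (by simp) x) (h1.differentiable (by simp) x)]
    simp
  have i1 := (integrable_mul_fderiv_test (v := v) l1 h1 h2 h3).integrableOn (s := S)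
  have i2 := (integrable_mul_test l3 h1.continuous h2 h3).integrableOn (s := S)
  have i3 := (integrable_mul_test l2 h1.continuous h2 h3).integrableOn (s := S)
  have e1 : ∀ x, u x * (fderiv ℝ (fun x => p x * φ x) x v : ℂ) =
      u x * (p x : ℂ) * (fderiv ℝ φ x v : ℂ) + u x * (fderiv ℝ p x v : ℂ) * (φ x : ℂ) := by
    intro x; rw [hd]; push_cast; ring
  have e2 : ∀ x, h x * ((p x * φ x : ℝ) : ℂ) = h x * (p x : ℂ) * (φ x : ℂ) := by
    intro x; push_cast; ring
  simp_rw [e1, e2] at e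
  rw [integral_add i1 i2] at e
  simp_rw [add_mul]
  rw [integral_add i3 i2]
  linear_combination e

/-- Test functions are real-valued, so a complex factor is split as `Re e + i Im e` and each part is
treated by `mul_real`. This is what differentiates the exponential in a Bloch wave. -/
theorem mul_smooth (hS : IsOpen S) (H : HasWeakDerivOn S v u h) {e : ℝ × ℝ → ℂ}
    (he : ContDiff ℝ (⊤ : ℕ∞) e) :
    HasWeakDerivOn S v (fun x => u x * e x) (fun x => h x * e x + u x * fderiv ℝ e x v) := by
  have hr : ContDiff ℝ (⊤ : ℕ∞) fun x => (e x).re := Complex.reCLM.contDiff.comp he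
  have hi : ContDiff ℝ (⊤ : ℕ∞) fun x => (e x).im := Complex.imCLM.contDiff.comp he
  have hd : Differentiable ℝ e := he.differentiable (by simp)
  have dr : ∀ x, fderiv ℝ (fun x => (e x).re) x v = (fderiv ℝ e x v).re := fun x => by
    have := (Complex.reCLM.hasFDerivAt.comp x (hd x).hasFDerivAt).fderiv
    exact congrArg (fun T => T v) this
  have di : ∀ x, fderiv ℝ (fun x => (e x).im) x v = (fderiv ℝ e x v).im := fun x => by
    have := (Complex.imCLM.hasFDerivAt.comp x (hd x).hasFDerivAt).fderiv
    exact congrArg (fun T => T v) this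
  have K := (H.mul_real hS hr).add ((H.mul_real hS hi).const_mul Complex.I)
  convert K using 2 with x x
  · nth_rw 1 [← Complex.re_add_im (e x)]; ring
  · rw [dr, di]
    nth_rw 1 [← Complex.re_add_im (e x), ← Complex.re_add_im (fderiv ℝ e x v)]; ring

theorem comp_add_right (H : HasWeakDerivOn S v u h) (t : ℝ × ℝ) :
    HasWeakDerivOn ((· + t) ⁻¹' S) v (fun x => u (x + t)) (fun x => h (x + t)) := by
  have mp : MeasurePreserving (fun x : ℝ × ℝ => x + t) volume volume :=
    measurePreserving_add_right volume t
  have me : MeasurableEmbedding (fun x : ℝ × ℝ => x + t) := measurableEmbedding_addRight t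
  have loc : ∀ {f : ℝ × ℝ → ℂ}, LocallyIntegrableOn f S volume →
      LocallyIntegrableOn (fun x => f (x + t)) ((· + t) ⁻¹' S) volume := by
    intro f hf x hx
    obtain ⟨s, hs, hi⟩ := hf (x + t) hx
    refine ⟨(· + t) ⁻¹' s, ?_, (mp.integrableOn_comp_preimage me).2 hi⟩
    exact (((continuous_add_const t).continuousWithinAt (s := (· + t) ⁻¹' S) (x := x)).tendsto_nhdsWithin
      (mapsTo_preimage _ _)) hs
  refine ⟨loc H.1, loc H.2.1, fun φ h1 h2 h3 => ?_⟩
  have hψ : ContDiff ℝ (⊤ : ℕ∞) fun x => φ (x - t) := h1.comp (by fun_prop)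
  have hts : tsupport (fun x => φ (x - t)) = (· + t) '' tsupport φ := by
    have := tsupport_comp_eq_preimage φ (Homeomorph.addRight (-t))
    have e : (fun x => φ (x - t)) = φ ∘ (Homeomorph.addRight (-t)) := by
      ext x; simp [sub_eq_add_neg]
    rw [e, this]
    ext x
    simp [← sub_eq_add_neg]
  have e := H.2.2 (fun x => φ (x - t)) hψ
    (by rw [HasCompactSupport, hts]; exact h2.isCompact.image (continuous_add_const t))
    (by rw [hts]; rintro _ ⟨x, hx, rfl⟩; exact h3 hx)
  have hf : ∀ x, fderiv ℝ (fun x => φ (x - t)) x v = fderiv ℝ φ (x - t) v := fun x => by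
    rw [fderiv_comp_sub]
  simp_rw [hf] at e
  rw [← mp.setIntegral_preimage_emb me _ S,
    ← mp.setIntegral_preimage_emb me (fun x => h x * (φ (x - t) : ℂ)) S] at e
  simpa using e

end HasWeakDerivOn

/-! ### Weak gradients -/

namespace HasWeakGradOn

theorem mono (H : HasWeakGradOn S u g) (hS : S' ⊆ S) : HasWeakGradOn S' u g :=
  hasWeakGradOn_iff.2 ((hasWeakGradOn_iff.1 H).imp (·.mono hS) (·.mono hS))

theorem ae_unique (hS : IsOpen S) (H : HasWeakGradOn S u g) (H' : HasWeakGradOn S u g') :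
    g =ᵐ[volume.restrict S] g' := by
  rw [hasWeakGradOn_iff] at H H'
  filter_upwards [H.1.ae_unique hS H'.1, H.2.ae_unique hS H'.2] with x h1 h2
  exact Prod.ext h1 h2

theorem congr_ae (H : HasWeakGradOn S u g) (hu : u =ᵐ[volume.restrict S] u') :
    HasWeakGradOn S u' g :=
  hasWeakGradOn_iff.2 ((hasWeakGradOn_iff.1 H).imp (·.congr_ae hu) (·.congr_ae hu))

theorem const_mul (H : HasWeakGradOn S u g) (c : ℂ) :
    HasWeakGradOn S (fun x => c * u x) (fun x => c • g x) :=
  hasWeakGradOn_iff.2 ((hasWeakGradOn_iff.1 H).imp (·.const_mul c) (·.const_mul c))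

theorem comp_add_right (H : HasWeakGradOn S u g) (t : ℝ × ℝ) :
    HasWeakGradOn ((· + t) ⁻¹' S) (fun x => u (x + t)) (fun x => g (x + t)) :=
  hasWeakGradOn_iff.2 ((hasWeakGradOn_iff.1 H).imp (·.comp_add_right t) (·.comp_add_right t))

theorem sum {ι : Type*} (F : Finset ι) {u : ι → ℝ × ℝ → ℂ} {g : ι → ℝ × ℝ → ℂ × ℂ}
    (H : ∀ i ∈ F, HasWeakGradOn S (u i) (g i)) :
    HasWeakGradOn S (fun x => ∑ i ∈ F, u i x) (fun x => ∑ i ∈ F, g i x) := by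
  rw [hasWeakGradOn_iff]
  simp_rw [Prod.fst_sum, Prod.snd_sum]
  exact ⟨HasWeakDerivOn.sum F fun i hi => (hasWeakGradOn_iff.1 (H i hi)).1,
    HasWeakDerivOn.sum F fun i hi => (hasWeakGradOn_iff.1 (H i hi)).2⟩

theorem mul_smooth (hS : IsOpen S) (H : HasWeakGradOn S u g) {e : ℝ × ℝ → ℂ}
    (he : ContDiff ℝ (⊤ : ℕ∞) e) :
    HasWeakGradOn S (fun x => u x * e x)
      (fun x => ((g x).1 * e x + u x * fderiv ℝ e x (1, 0),
        (g x).2 * e x + u x * fderiv ℝ e x (0, 1))) :=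
  hasWeakGradOn_iff.2 ((hasWeakGradOn_iff.1 H).imp (·.mul_smooth hS he) (·.mul_smooth hS he))

theorem weakGrad (H : HasWeakGradOn S u g) : HasWeakGradOn S u (weakGrad S u) := by
  have h : ∃ g, HasWeakGradOn S u g := ⟨g, H⟩
  rw [Waveguide.weakGrad, dif_pos h]
  exact h.choose_spec

theorem weakGrad_ae_eq (hS : IsOpen S) (H : HasWeakGradOn S u g) :
    Waveguide.weakGrad S u =ᵐ[volume.restrict S] g :=
  H.weakGrad.ae_unique hS H

end HasWeakGradOn


/-! ### Integrals of quasi-periodic functions -/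

/-- `f` is multiplied by `c.1` (by `c.2`) under translation by `ε` in the first (second)
variable. -/
def QuasiPeriodic {𝕜 : Type*} [RCLike 𝕜] (ε : ℝ) (c : 𝕜 × 𝕜) (f : ℝ × ℝ → 𝕜) : Prop :=
  (∀ᵐ x, f (x + (ε, 0)) = c.1 * f x) ∧ ∀ᵐ x, f (x + (0, ε)) = c.2 * f x

section Tiling

variable {𝕜 : Type*} [RCLike 𝕜] {f : ℝ × ℝ → 𝕜} {c : 𝕜} {t : ℝ × ℝ}

theorem ae_add_nsmul_of_ae_add (hf : ∀ᵐ x, f (x + t) = c * f x) (n : ℕ) :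
    ∀ᵐ x, f (x + n • t) = c ^ n * f x := by
  induction n with
  | zero => simp
  | succ n ih =>
    have := (measurePreserving_add_right volume (n • t)).quasiMeasurePreserving.ae hf
    filter_upwards [ih, this] with x h1 h2
    rw [succ_nsmul, ← add_assoc, h2, h1, pow_succ]; ring

theorem integrableOn_translate (hf : ∀ᵐ x, f (x + t) = c * f x) {A B : Set (ℝ × ℝ)} {n : ℕ}
    (hB : (· + n • t) ⁻¹' B = A) (hi : IntegrableOn f A) :
    IntegrableOn f B ∧ ∫ x in B, f x = c ^ n * ∫ x in A, f x := by
  have mp : MeasurePreserving (fun x : ℝ × ℝ => x + n • t) volume volume :=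
    measurePreserving_add_right volume (n • t)
  have me : MeasurableEmbedding (fun x : ℝ × ℝ => x + n • t) := measurableEmbedding_addRight _
  have hn := ae_add_nsmul_of_ae_add hf n
  constructor
  · rw [← mp.integrableOn_comp_preimage me, hB]
    refine (hi.const_mul (c ^ n)).congr ?_
    filter_upwards [ae_restrict_of_ae hn] with x hx
    exact hx.symm
  · rw [← mp.setIntegral_preimage_emb me, hB, ← integral_const_mul]
    refine integral_congr_ae ?_
    filter_upwards [ae_restrict_of_ae hn] with x hx
    exact hx

/-- The `n`-th translate of `A` contributes `c ^ n` times the integral over `A`, so stacking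
translates produces a geometric sum. -/
theorem integral_iUnion_translates (hf : ∀ᵐ x, f (x + t) = c * f x) {A : Set (ℝ × ℝ)}
    {B S : ℕ → Set (ℝ × ℝ)} (hB : ∀ n, (· + n • t) ⁻¹' B n = A) (hBm : ∀ n, MeasurableSet (B n))
    (h0 : S 0 = ∅) (hS : ∀ n, S (n + 1) = S n ∪ B n) (hd : ∀ n, Disjoint (S n) (B n))
    (hi : IntegrableOn f A) (n : ℕ) :
    IntegrableOn f (S n) ∧
      ∫ x in S n, f x = (∑ k ∈ Finset.range n, c ^ k) * ∫ x in A, f x := by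
  induction n with
  | zero => simp [h0]
  | succ n ih =>
    obtain ⟨h1, h2⟩ := integrableOn_translate hf (hB n) hi
    rw [hS]
    refine ⟨ih.1.union h1, ?_⟩
    rw [setIntegral_union (hd n) (hBm n) ih.1 h1, ih.2, h2, Finset.sum_range_succ]
    ring

end Tiling

theorem Ioc_zero_mul_succ {ε : ℝ} (hε : 0 < ε) (n : ℕ) :
    Ioc 0 (ε * (n + 1 : ℕ)) = Ioc 0 (ε * n) ∪ Ioc (ε * n) (ε * n + ε) := by
  rw [Ioc_union_Ioc_eq_Ioc (by positivity) (by linarith)]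
  push_cast
  ring_nf

/-- Half-open cells tile the half-open box exactly; open ones would omit the null interfaces. -/
theorem box_ae_eq (ε : ℝ) (L K : ℕ) :
    box ε L K =ᵐ[volume] Ioc 0 (ε * L) ×ˢ Ioc 0 (ε * K) :=
  Measure.set_prod_ae_eq Ioo_ae_eq_Ioc Ioo_ae_eq_Ioc

theorem cell_ae_eq (ε : ℝ) : cell ε =ᵐ[volume] Ioc 0 ε ×ˢ Ioc 0 ε :=
  Measure.set_prod_ae_eq Ioo_ae_eq_Ioc Ioo_ae_eq_Ioc

/-- Cells are stacked vertically into a column, then columns horizontally into the box; each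
direction yields its own geometric sum. -/
theorem QuasiPeriodic.integral_box {𝕜 : Type*} [RCLike 𝕜] {ε : ℝ} (hε : 0 < ε) {c : 𝕜 × 𝕜}
    {f : ℝ × ℝ → 𝕜} (hf : QuasiPeriodic ε c f) (hi : IntegrableOn f (cell ε)) (L K : ℕ) :
    IntegrableOn f (box ε L K) ∧
      ∫ x in box ε L K, f x = (∑ k ∈ Finset.range L, c.1 ^ k) *
        ((∑ k ∈ Finset.range K, c.2 ^ k) * ∫ x in cell ε, f x) := by
  rw [integrableOn_congr_set_ae (cell_ae_eq ε)] at hi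
  rw [integrableOn_congr_set_ae (box_ae_eq ε L K), setIntegral_congr_set (box_ae_eq ε L K),
    setIntegral_congr_set (cell_ae_eq ε)]
  have h2 := integral_iUnion_translates hf.2 (A := Ioc 0 ε ×ˢ Ioc 0 ε)
    (B := fun n => Ioc 0 ε ×ˢ Ioc (ε * n) (ε * n + ε)) (S := fun n => Ioc 0 ε ×ˢ Ioc 0 (ε * n))
    (fun n => by ext x; simp [mul_comm ε, add_comm x.2])
    (fun n => measurableSet_Ioc.prod measurableSet_Ioc) (by simp)
    (fun n => by rw [Ioc_zero_mul_succ hε, prod_union])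
    (fun n => by
      rw [disjoint_prod]
      exact Or.inr (Ioc_disjoint_Ioc_of_le le_rfl)) hi K
  have h1 := integral_iUnion_translates hf.1 (A := Ioc 0 ε ×ˢ Ioc 0 (ε * K))
    (B := fun n => Ioc (ε * n) (ε * n + ε) ×ˢ Ioc 0 (ε * K))
    (S := fun n => Ioc 0 (ε * n) ×ˢ Ioc 0 (ε * K))
    (fun n => by ext x; simp [mul_comm ε, add_comm x.1])
    (fun n => measurableSet_Ioc.prod measurableSet_Ioc) (by simp)
    (fun n => by rw [Ioc_zero_mul_succ hε, union_prod])
    (fun n => by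
      rw [disjoint_prod]
      exact Or.inl (Ioc_disjoint_Ioc_of_le le_rfl)) h2.1 L
  exact ⟨h1.1, by rw [h1.2, h2.2]⟩

theorem isOpen_box (ε : ℝ) (L K : ℕ) : IsOpen (box ε L K) := isOpen_Ioo.prod isOpen_Ioo

theorem isOpen_cell (ε : ℝ) : IsOpen (cell ε) := isOpen_Ioo.prod isOpen_Ioo

theorem cell_subset_box {ε : ℝ} (hε : 0 < ε) {L K : ℕ} (hL : 0 < L) (hK : 0 < K) :
    cell ε ⊆ box ε L K := by
  have h1 : (1 : ℝ) ≤ L := by exact_mod_cast hL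
  have h2 : (1 : ℝ) ≤ K := by exact_mod_cast hK
  exact prod_mono (Ioo_subset_Ioo_right (by nlinarith)) (Ioo_subset_Ioo_right (by nlinarith))

theorem volume_real_box {ε : ℝ} (hε : 0 < ε) (L K : ℕ) :
    volume.real (box ε L K) = ε * L * (ε * K) := by
  rw [box, Measure.volume_eq_prod, measureReal_prod_prod, Real.volume_real_Ioo_of_le (by positivity),
    Real.volume_real_Ioo_of_le (by positivity)]
  simp

theorem volume_real_cell {ε : ℝ} (hε : 0 < ε) : volume.real (cell ε) = ε * ε := by
  rw [cell, Measure.volume_eq_prod, measureReal_prod_prod, Real.volume_real_Ioo_of_le hε.le]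
  simp

/-- Since the multipliers are unimodular, `|f|²` is genuinely periodic, and its integrability on one
cell passes to the box. -/
theorem QuasiPeriodic.memLp_box {ε : ℝ} (hε : 0 < ε) {c : ℂ × ℂ} (hc1 : ‖c.1‖ = 1)
    (hc2 : ‖c.2‖ = 1) {f : ℝ × ℝ → ℂ} (hf : QuasiPeriodic ε c f)
    (hl : LocallyIntegrableOn f univ volume) (hi : MemLp f 2 (volume.restrict (cell ε)))
    (L K : ℕ) : MemLp f 2 (volume.restrict (box ε L K)) := by
  have hm : AEStronglyMeasurable f volume := (locallyIntegrableOn_univ.1 hl).aestronglyMeasurable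
  rw [memLp_two_iff_integrable_sq_norm hm.restrict] at hi ⊢
  have hq : QuasiPeriodic ε ((1, 1) : ℝ × ℝ) fun x => ‖f x‖ ^ 2 :=
    ⟨by filter_upwards [hf.1] with x hx; simp [hx, hc1],
      by filter_upwards [hf.2] with x hx; simp [hx, hc2]⟩
  exact (hq.integral_box hε hi L K).1

/-- The average over the box of a periodic function is its average over the cell. -/
theorem QuasiPeriodic.average_box {ε : ℝ} (hε : 0 < ε) {f : ℝ × ℝ → ℂ}
    (hf : QuasiPeriodic ε (1, 1) f) (hi : IntegrableOn f (cell ε)) {L K : ℕ} (hL : 0 < L)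
    (hK : 0 < K) : ⨍ x in box ε L K, f x = ⨍ x in cell ε, f x := by
  have hL' : (L : ℂ) ≠ 0 := by exact_mod_cast hL.ne'
  have hK' : (K : ℂ) ≠ 0 := by exact_mod_cast hK.ne'
  have hε' : (ε : ℂ) ≠ 0 := by exact_mod_cast hε.ne'
  rw [setAverage_eq, setAverage_eq, volume_real_box hε, volume_real_cell hε,
    (hf.integral_box hε hi L K).2]
  simp only [one_pow, Finset.sum_const, Finset.card_range, nsmul_eq_mul, mul_one,
    Complex.real_smul]
  push_cast
  field_simp


/-! ### Phases -/

/-- The phase factor `exp(2πi q)`. -/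
def phase (q : ℝ) : ℂ := Complex.exp (2 * Real.pi * Complex.I * (q : ℝ))

theorem norm_phase (q : ℝ) : ‖phase q‖ = 1 := by
  have : phase q = Complex.exp ((2 * Real.pi * q : ℝ) * Complex.I) := by
    rw [phase]; push_cast; ring_nf
  rw [this, Complex.norm_exp_ofReal_mul_I]

theorem conj_phase_mul_self (q : ℝ) : conj (phase q) * phase q = 1 := by
  rw [Complex.conj_mul', norm_phase]; simp

theorem phase_add (p q : ℝ) : phase (p + q) = phase p * phase q := by
  rw [phase, phase, phase, ← Complex.exp_add]; push_cast; ring_nf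

theorem phase_pow_eq_one {n : ℕ} {q : ℝ} (hq : q ∈ gridQ n) : phase q ^ n = 1 := by
  obtain ⟨k, hk, rfl⟩ := hq
  have hn : (n : ℂ) ≠ 0 := by exact_mod_cast (by lia : n ≠ 0)
  rw [phase, ← Complex.exp_nat_mul, Complex.exp_eq_one_iff]
  refine ⟨k, ?_⟩
  push_cast
  field_simp

theorem gridQ_subset_Ico (n : ℕ) : gridQ n ⊆ Ico 0 1 := by
  rintro _ ⟨k, hk, rfl⟩
  have hn : (0 : ℝ) < n := by exact_mod_cast (by lia : 0 < n)
  exact ⟨by positivity, by rw [div_lt_one hn]; exact_mod_cast hk⟩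

theorem phase_injOn (n : ℕ) : InjOn phase (gridQ n) := by
  intro p hp q hq h
  obtain ⟨hp0, hp1⟩ := gridQ_subset_Ico n hp
  obtain ⟨hq0, hq1⟩ := gridQ_subset_Ico n hq
  obtain ⟨m, hm⟩ := Complex.exp_eq_exp_iff_exists_int.1 h
  have h2 : (2 * Real.pi * Complex.I : ℂ) ≠ 0 := Complex.two_pi_I_ne_zero
  have e : (p : ℂ) = q + m := by
    apply mul_left_cancel₀ h2
    rw [hm]; ring
  have e' : p = q + m := by exact_mod_cast e
  have m1 : m < 1 := by exact_mod_cast (by linarith : (m : ℝ) < 1)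
  have m2 : -1 < m := by exact_mod_cast (by linarith : (-1 : ℝ) < m)
  have : m = 0 := by lia
  simpa [this] using e'

/-- Distinct grid points have orthogonal characters. -/
theorem sum_conj_phase_mul_phase_pow {n : ℕ} {p q : ℝ} (hp : p ∈ gridQ n) (hq : q ∈ gridQ n)
    (hpq : p ≠ q) : ∑ k ∈ Finset.range n, (conj (phase p) * phase q) ^ k = 0 := by
  have h1 : conj (phase p) * phase q ≠ 1 := by
    intro h
    refine hpq (phase_injOn n hp hq ?_)
    calc phase p = phase p * (conj (phase p) * phase q) := by rw [h, mul_one]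
      _ = conj (phase p) * phase p * phase q := by ring
      _ = phase q := by rw [conj_phase_mul_self, one_mul]
  -- Both phases are `n`-th roots of unity, so the numerator of the geometric sum vanishes.
  rw [geom_sum_eq h1, mul_pow, ← map_pow, phase_pow_eq_one hp, phase_pow_eq_one hq]
  simp

/-! ### Regularity and quasi-periodicity of Bloch waves -/

variable {ε : ℝ} {Ψ : ℝ × ℝ → ℕ → ℝ × ℝ → ℂ} {l : (ℝ × ℝ) × ℕ}

theorem contDiff_blochFactor (ε : ℝ) (j : ℝ × ℝ) :
    ContDiff ℝ (⊤ : ℕ∞) fun x : ℝ × ℝ => phase ((j.1 * x.1 + j.2 * x.2) / ε) := by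
  unfold phase
  have h : ContDiff ℝ (⊤ : ℕ∞) fun x : ℝ × ℝ => (((j.1 * x.1 + j.2 * x.2) / ε : ℝ) : ℂ) :=
    Complex.ofRealCLM.contDiff.comp (ContDiff.div_const (by fun_prop) ε)
  exact (contDiff_const.mul h).cexp

theorem hasWeakGradOn_blochWave (h : MemH1Per ε (Ψ l.1 l.2)) :
    HasWeakGradOn univ (blochWave ε Ψ l) (weakGrad univ (blochWave ε Ψ l)) := by
  obtain ⟨-, -, g, hg, -⟩ := h
  exact (hg.mul_smooth isOpen_univ (contDiff_blochFactor ε l.1)).weakGrad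

theorem norm_blochWave (x : ℝ × ℝ) : ‖blochWave ε Ψ l x‖ = ‖Ψ l.1 l.2 x‖ := by
  have : blochWave ε Ψ l x = Ψ l.1 l.2 x * phase ((l.1.1 * x.1 + l.1.2 * x.2) / ε) := rfl
  rw [this, norm_mul, norm_phase, mul_one]

theorem memLp_mul_continuous_cell {f χ : ℝ × ℝ → ℂ} (hf : MemLp f 2 (volume.restrict (cell ε)))
    (hχ : Continuous χ) : MemLp (fun x => f x * χ x) 2 (volume.restrict (cell ε)) := by
  obtain ⟨C, hC⟩ := (isCompact_Icc (a := ((0, 0) : ℝ × ℝ)) (b := (ε, ε))).exists_bound_of_continuousOn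
    hχ.continuousOn
  refine MemLp.of_le_mul (c := C) hf (hf.1.mul hχ.aestronglyMeasurable) ?_
  refine (ae_restrict_iff' (isOpen_cell ε).measurableSet).2 (ae_of_all _ fun x hx => ?_)
  rw [norm_mul, mul_comm]
  refine mul_le_mul_of_nonneg_right (hC x ?_) (norm_nonneg _)
  exact ⟨⟨hx.1.1.le, hx.2.1.le⟩, ⟨hx.1.2.le, hx.2.2.le⟩⟩

theorem memLp_blochWave_cell (h : MemH1Per ε (Ψ l.1 l.2)) :
    MemLp (blochWave ε Ψ l) 2 (volume.restrict (cell ε)) :=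
  memLp_mul_continuous_cell h.2.1 (contDiff_blochFactor ε l.1).continuous

theorem memLp_weakGrad_blochWave_cell (h : MemH1Per ε (Ψ l.1 l.2)) :
    MemLp (fun x => (weakGrad univ (blochWave ε Ψ l) x).1) 2 (volume.restrict (cell ε)) := by
  obtain ⟨-, hu, g, hg, hg2⟩ := h
  have hc := contDiff_blochFactor ε l.1
  have e := (hg.mul_smooth isOpen_univ hc).weakGrad_ae_eq isOpen_univ
  rw [Measure.restrict_univ] at e
  have m : MemLp (fun x => (g x).1 * phase ((l.1.1 * x.1 + l.1.2 * x.2) / ε) +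
      Ψ l.1 l.2 x * fderiv ℝ (fun x : ℝ × ℝ => phase ((l.1.1 * x.1 + l.1.2 * x.2) / ε)) x (1, 0)) 2
      (volume.restrict (cell ε)) :=
    (memLp_mul_continuous_cell hg2.fst hc.continuous).add (memLp_mul_continuous_cell hu
      ((hc.continuous_fderiv (by simp)).clm_apply continuous_const))
  refine m.ae_eq ?_
  filter_upwards [ae_restrict_of_ae e] with x hx
  exact (congrArg Prod.fst hx).symm

theorem blochWave_add (hε : 0 < ε) (h : MemH1Per ε (Ψ l.1 l.2)) (x : ℝ × ℝ) :
    blochWave ε Ψ l (x + (ε, 0)) = phase l.1.1 * blochWave ε Ψ l x ∧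
      blochWave ε Ψ l (x + (0, ε)) = phase l.1.2 * blochWave ε Ψ l x := by
  have hb : ∀ x, blochWave ε Ψ l x = Ψ l.1 l.2 x * phase ((l.1.1 * x.1 + l.1.2 * x.2) / ε) :=
    fun _ => rfl
  have hp := h.1 x
  have e1 : x + (ε, 0) = (x.1 + ε, x.2) := by ext <;> simp
  have e2 : x + (0, ε) = (x.1, x.2 + ε) := by ext <;> simp
  have a1 : (l.1.1 * (x.1 + ε) + l.1.2 * x.2) / ε = (l.1.1 * x.1 + l.1.2 * x.2) / ε + l.1.1 := by
    field_simp; ring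
  have a2 : (l.1.1 * x.1 + l.1.2 * (x.2 + ε)) / ε = (l.1.1 * x.1 + l.1.2 * x.2) / ε + l.1.2 := by
    field_simp; ring
  constructor
  · rw [hb, hb, e1, hp.1, a1, phase_add]; ring
  · rw [hb, hb, e2, hp.2, a2, phase_add]; ring

/-- Both sides are weak gradients of the same function `u (· + t) = c u`; uniqueness makes them
agree, but only almost everywhere. -/
theorem HasWeakGradOn.ae_add {u : ℝ × ℝ → ℂ} {g : ℝ × ℝ → ℂ × ℂ} (H : HasWeakGradOn univ u g)
    {t : ℝ × ℝ} {c : ℂ} (hu : ∀ x, u (x + t) = c * u x) : ∀ᵐ x, g (x + t) = c • g x := by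
  have h1 := H.comp_add_right t
  simp_rw [hu] at h1
  have h2 := h1.ae_unique isOpen_univ (H.const_mul c)
  rwa [Measure.restrict_univ] at h2

theorem quasiPeriodic_blochWave (hε : 0 < ε) (h : MemH1Per ε (Ψ l.1 l.2)) :
    QuasiPeriodic ε (phase l.1.1, phase l.1.2) (blochWave ε Ψ l) :=
  ⟨ae_of_all _ fun x => (blochWave_add hε h x).1, ae_of_all _ fun x => (blochWave_add hε h x).2⟩

theorem quasiPeriodic_weakGrad_blochWave (hε : 0 < ε) (h : MemH1Per ε (Ψ l.1 l.2)) :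
    QuasiPeriodic ε (phase l.1.1, phase l.1.2)
      (fun x => (weakGrad univ (blochWave ε Ψ l) x).1) := by
  have H := hasWeakGradOn_blochWave h
  constructor
  · filter_upwards [H.ae_add fun x => (blochWave_add hε h x).1] with x hx
    exact congrArg Prod.fst hx
  · filter_upwards [H.ae_add fun x => (blochWave_add hε h x).2] with x hx
    exact congrArg Prod.fst hx

theorem memLp_blochWave_box (hε : 0 < ε) (h : MemH1Per ε (Ψ l.1 l.2)) (L K : ℕ) :
    MemLp (blochWave ε Ψ l) 2 (volume.restrict (box ε L K)) :=
  (quasiPeriodic_blochWave hε h).memLp_box hε (norm_phase _) (norm_phase _)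
    (hasWeakGradOn_blochWave h).1 (memLp_blochWave_cell h) L K

theorem memLp_weakGrad_blochWave_box (hε : 0 < ε) (h : MemH1Per ε (Ψ l.1 l.2)) (L K : ℕ) :
    MemLp (fun x => (weakGrad univ (blochWave ε Ψ l) x).1) 2 (volume.restrict (box ε L K)) :=
  (quasiPeriodic_weakGrad_blochWave hε h).memLp_box hε (norm_phase _) (norm_phase _)
    (hasWeakGradOn_iff.1 (hasWeakGradOn_blochWave h)).1.2.1 (memLp_weakGrad_blochWave_cell h) L K

/-! ### Orthogonality -/

theorem memLp_real_mul {a : ℝ × ℝ → ℝ} {μ : Measure (ℝ × ℝ)} {M : ℝ}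
    (ha : AEStronglyMeasurable a μ) (hM : ∀ᵐ x ∂μ, |a x| ≤ M) {f : ℝ × ℝ → ℂ}
    (hf : MemLp f 2 μ) : MemLp (fun x => (a x : ℂ) * f x) 2 μ := by
  refine MemLp.of_le_mul (c := M) hf
    ((Complex.continuous_ofReal.comp_aestronglyMeasurable ha).mul hf.1) ?_
  filter_upwards [hM] with x hx
  rw [norm_mul, Complex.norm_real, Real.norm_eq_abs]
  exact mul_le_mul_of_nonneg_right hx (norm_nonneg _)

theorem integrable_conj_mul {μ : Measure (ℝ × ℝ)} {f g : ℝ × ℝ → ℂ} (hf : MemLp f 2 μ)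
    (hg : MemLp g 2 μ) : Integrable (fun x => conj (f x) * g x) μ :=
  MemLp.integrable_mul hf.star hg

theorem QuasiPeriodic.conj_mul {c d : ℂ × ℂ} {f g : ℝ × ℝ → ℂ} (hf : QuasiPeriodic ε c f)
    (hg : QuasiPeriodic ε d g) :
    QuasiPeriodic ε (conj c.1 * d.1, conj c.2 * d.2) fun x => conj (f x) * g x := by
  constructor
  · filter_upwards [hf.1, hg.1] with x h1 h2
    rw [h1, h2, map_mul]; ring
  · filter_upwards [hf.2, hg.2] with x h1 h2
    rw [h1, h2, map_mul]; ring

theorem QuasiPeriodic.real_mul {c : ℂ × ℂ} {f : ℝ × ℝ → ℂ} (hf : QuasiPeriodic ε c f)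
    {a : ℝ × ℝ → ℝ} (ha : CellPeriodic ε a) : QuasiPeriodic ε c fun x => (a x : ℂ) * f x := by
  have e1 : ∀ x : ℝ × ℝ, a (x + (ε, 0)) = a x := fun x => by
    rw [← (ha x).1]; congr 1; ext <;> simp
  have e2 : ∀ x : ℝ × ℝ, a (x + (0, ε)) = a x := fun x => by
    rw [← (ha x).2]; congr 1; ext <;> simp
  constructor
  · filter_upwards [hf.1] with x h1
    rw [h1, e1]; ring
  · filter_upwards [hf.2] with x h1
    rw [h1, e2]; ring

theorem integral_box_conj_mul_eq_zero (hε : 0 < ε) {L K : ℕ} (hL : 0 < L) (hK : 0 < K)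
    {j j' : ℝ × ℝ} (hj : j ∈ gridQ L ×ˢ gridQ K) (hj' : j' ∈ gridQ L ×ˢ gridQ K) (hne : j ≠ j')
    {f g : ℝ × ℝ → ℂ} (hf : QuasiPeriodic ε (phase j.1, phase j.2) f)
    (hg : QuasiPeriodic ε (phase j'.1, phase j'.2) g)
    (hi : IntegrableOn (fun x => conj (f x) * g x) (box ε L K)) :
    ∫ x in box ε L K, conj (f x) * g x = 0 := by
  rw [((hf.conj_mul hg).integral_box hε (hi.mono_set (cell_subset_box hε hL hK)) L K).2]
  by_cases h1 : j.1 = j'.1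
  · have h2 : j.2 ≠ j'.2 := fun h => hne (Prod.ext h1 h)
    simp only [sum_conj_phase_mul_phase_pow hj.2 hj'.2 h2, zero_mul, mul_zero]
  · simp only [sum_conj_phase_mul_phase_pow hj.1 hj'.1 h1, zero_mul]

theorem average_box_conj_mul (hε : 0 < ε) {L K : ℕ} (hL : 0 < L) (hK : 0 < K) {j : ℝ × ℝ}
    {f g : ℝ × ℝ → ℂ} (hf : QuasiPeriodic ε (phase j.1, phase j.2) f)
    (hg : QuasiPeriodic ε (phase j.1, phase j.2) g)
    (hi : IntegrableOn (fun x => conj (f x) * g x) (box ε L K)) :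
    ⨍ x in box ε L K, conj (f x) * g x = ⨍ x in cell ε, conj (f x) * g x := by
  have h := hf.conj_mul hg
  simp only [conj_phase_mul_self] at h
  exact h.average_box hε (hi.mono_set (cell_subset_box hε hL hK)) hL hK

/-- Two families are allowed so that the same expansion serves the mass (`q = p`) and the flux (`q =
a ∂₁p`). -/
theorem integral_conj_sum_mul_sum {ι : Type*} (F : Finset ι) (α : ι → ℂ) {p q : ι → ℝ × ℝ → ℂ}
    {μ : Measure (ℝ × ℝ)}
    (hi : ∀ k ∈ F, ∀ m ∈ F, Integrable (fun x => conj (p k x) * q m x) μ)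
    (ho : ∀ k ∈ F, ∀ m ∈ F, k ≠ m → ∫ x, conj (p k x) * q m x ∂μ = 0) :
    ∫ x, conj (∑ k ∈ F, α k * p k x) * (∑ m ∈ F, α m * q m x) ∂μ =
      ∑ k ∈ F, ((‖α k‖ ^ 2 : ℝ) : ℂ) * ∫ x, conj (p k x) * q k x ∂μ := by
  have e : ∀ x, conj (∑ k ∈ F, α k * p k x) * (∑ m ∈ F, α m * q m x) =
      ∑ k ∈ F, ∑ m ∈ F, conj (α k) * α m * (conj (p k x) * q m x) := fun x => by
    rw [map_sum, Finset.sum_mul_sum]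
    refine Finset.sum_congr rfl fun k _ => Finset.sum_congr rfl fun m _ => ?_
    rw [map_mul]; ring
  simp_rw [e]
  rw [integral_finsetSum _ fun k hk =>
    integrable_finsetSum _ fun m hm => (hi k hk m hm).const_mul _]
  refine Finset.sum_congr rfl fun k hk => ?_
  rw [integral_finsetSum _ fun m hm => (hi k hk m hm).const_mul _,
    Finset.sum_eq_single_of_mem k hk fun m hm hne => by
      rw [integral_const_mul, ho k hk m hm hne.symm, mul_zero],
    integral_const_mul, Complex.conj_mul']
  push_cast
  rfl

/-! ### The energy flux on a span of Bloch waves -/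

/-- Expansion of a function in the span of Bloch waves with distinct wave numbers: both the mean
square and the energy flux are diagonal. -/
theorem exists_diagonal_expansion (hε : 0 < ε) {L K : ℕ} (hL : 0 < L) (hK : 0 < K)
    {a : ℝ × ℝ → ℝ} (ha : CellPeriodic ε a)
    (ham : AEStronglyMeasurable a (volume.restrict (box ε L K))) {M : ℝ}
    (hM : ∀ᵐ x ∂volume.restrict (box ε L K), |a x| ≤ M) {μ : ℝ × ℝ → ℕ → ℝ}
    (hΨ : IsBlochFamily ε a Ψ μ) {I : Set ((ℝ × ℝ) × ℕ)} (hI : I ⊆ indexSet L K)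
    (hne : ∀ l ∈ I, ∀ l' ∈ I, l ≠ l' → l.1 ≠ l'.1) {w : ℝ × ℝ → ℂ}
    (hw : w ∈ blochSpan ε L K Ψ I) :
    ∃ (F : Finset ((ℝ × ℝ) × ℕ)) (ρ : (ℝ × ℝ) × ℕ → ℝ), ↑F ⊆ I ∧ (∀ l, 0 ≤ ρ l) ∧
      ⨍ x in box ε L K, ‖w x‖ ^ 2 = ∑ l ∈ F, ρ l ∧
      energyFlux a (box ε L K) w w =
        ∑ l ∈ F, (ρ l : ℂ) * energyFlux a (box ε L K) (blochWave ε Ψ l) (blochWave ε Ψ l) ∧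
      ∀ l ∈ F, energyFlux a (box ε L K) (blochWave ε Ψ l) (blochWave ε Ψ l) =
        energyFlux a (cell ε) (blochWave ε Ψ l) (blochWave ε Ψ l) := by
  classical
  obtain ⟨w', hw', hww'⟩ := hw
  obtain ⟨α, hα, rfl⟩ := (Finsupp.mem_span_image_iff_linearCombination ℂ).1 hw'
  rw [Finsupp.mem_supported] at hα
  set F := α.support
  set U : (ℝ × ℝ) × ℕ → ℝ × ℝ → ℂ := blochWave ε Ψ
  set D : (ℝ × ℝ) × ℕ → ℝ × ℝ → ℂ := fun l x => (weakGrad univ (U l) x).1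
  have hsum : ∀ x, Finsupp.linearCombination ℂ U α x = ∑ l ∈ F, α l * U l x := fun x => by
    simp [Finsupp.linearCombination_apply, Finsupp.sum, F]
  have hgrid : ∀ l ∈ F, l.1 ∈ gridQ L ×ˢ gridQ K := fun l hl => hI (hα hl)
  have hIcc : ∀ l ∈ F, l.1 ∈ Icc (0 : ℝ) 1 ×ˢ Icc (0 : ℝ) 1 := fun l hl =>
    ⟨Ico_subset_Icc_self (gridQ_subset_Ico L (hgrid l hl).1),
      Ico_subset_Icc_self (gridQ_subset_Ico K (hgrid l hl).2)⟩
  have hper : ∀ l ∈ F, MemH1Per ε (Ψ l.1 l.2) := fun l hl => (hΨ.eigen l.1 (hIcc l hl) l.2).1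
  have hneF : ∀ l ∈ F, ∀ l' ∈ F, l ≠ l' → l.1 ≠ l'.1 := fun l hl l' hl' =>
    hne l (hα hl) l' (hα hl')
  have hG : ∀ l ∈ F, HasWeakGradOn univ (U l) (weakGrad univ (U l)) := fun l hl =>
    hasWeakGradOn_blochWave (hper l hl)
  have qU : ∀ l ∈ F, QuasiPeriodic ε (phase l.1.1, phase l.1.2) (U l) := fun l hl =>
    quasiPeriodic_blochWave hε (hper l hl)
  have qD : ∀ l ∈ F, QuasiPeriodic ε (phase l.1.1, phase l.1.2) fun x => (a x : ℂ) * D l x :=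
    fun l hl => (quasiPeriodic_weakGrad_blochWave hε (hper l hl)).real_mul ha
  have mU : ∀ l ∈ F, MemLp (U l) 2 (volume.restrict (box ε L K)) := fun l hl =>
    memLp_blochWave_box hε (hper l hl) L K
  have mD : ∀ l ∈ F, MemLp (fun x => (a x : ℂ) * D l x) 2 (volume.restrict (box ε L K)) :=
    fun l hl => memLp_real_mul ham hM (memLp_weakGrad_blochWave_box hε (hper l hl) L K)
  -- The flux is defined with the weak gradient local to `B`; replacing it by the gradient on the
  -- whole plane makes cell and box comparable.
  have flux : ∀ l ∈ F, ∀ B : Set (ℝ × ℝ), IsOpen B →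
      energyFlux a B (U l) (U l) = ⨍ x in B, conj (U l x) * ((a x : ℂ) * D l x) := by
    intro l hl B hB
    refine average_congr ?_
    filter_upwards [((hG l hl).mono (subset_univ B)).weakGrad_ae_eq hB] with x hx
    rw [hx]
  have hwG : weakGrad (box ε L K) w =ᵐ[volume.restrict (box ε L K)]
      fun x => ∑ l ∈ F, α l • weakGrad univ (U l) x := by
    have h := HasWeakGradOn.sum F fun l hl =>
      ((hG l hl).mono (subset_univ (box ε L K))).const_mul (α l)
    refine (h.congr_ae ?_).weakGrad_ae_eq (isOpen_box ε L K)
    filter_upwards [hww'] with x hx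
    rw [hx, hsum]
  have IU := integral_conj_sum_mul_sum F α
    (fun k hk m hm => integrable_conj_mul (mU k hk) (mU m hm))
    (fun k hk m hm hkm => integral_box_conj_mul_eq_zero hε hL hK (hgrid k hk) (hgrid m hm)
      (hneF k hk m hm hkm) (qU k hk) (qU m hm) (integrable_conj_mul (mU k hk) (mU m hm)))
  have ID := integral_conj_sum_mul_sum F α
    (fun k hk m hm => integrable_conj_mul (mU k hk) (mD m hm))
    (fun k hk m hm hkm => integral_box_conj_mul_eq_zero hε hL hK (hgrid k hk) (hgrid m hm)
      (hneF k hk m hm hkm) (qU k hk) (qD m hm) (integrable_conj_mul (mU k hk) (mD m hm)))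
  have hofReal : ∀ (B : Set (ℝ × ℝ)) (f : ℝ × ℝ → ℂ),
      ⨍ x in B, conj (f x) * f x = ((⨍ x in B, ‖f x‖ ^ 2 : ℝ) : ℂ) := by
    intro B f
    rw [setAverage_eq, setAverage_eq, smul_eq_mul, Complex.ofReal_mul, ← integral_complex_ofReal,
      Complex.real_smul]
    congr 2
    ext x
    rw [Complex.conj_mul']
    push_cast
    rfl
  refine ⟨F, fun l => ‖α l‖ ^ 2, hα, fun l => by positivity, ?_, ?_, ?_⟩
  · have h1 : ∀ l ∈ F, ⨍ x in box ε L K, conj (U l x) * U l x = 1 := by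
      intro l hl
      rw [average_box_conj_mul hε hL hK (qU l hl) (qU l hl)
        (integrable_conj_mul (mU l hl) (mU l hl)), hofReal]
      have := hΨ.normalized l.1 (hIcc l hl) l.2
      simp_rw [U, norm_blochWave]
      rw [this, Complex.ofReal_one]
    have h2 : ((⨍ x in box ε L K, ‖w x‖ ^ 2 : ℝ) : ℂ) = ((∑ l ∈ F, ‖α l‖ ^ 2 : ℝ) : ℂ) := by
      rw [← hofReal]
      have : ⨍ x in box ε L K, conj (w x) * w x =
          ⨍ x in box ε L K, conj (∑ l ∈ F, α l * U l x) * ∑ l ∈ F, α l * U l x := by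
        refine average_congr ?_
        filter_upwards [hww'] with x hx
        rw [hx, hsum]
      rw [this, setAverage_eq, IU, Finset.smul_sum, Complex.ofReal_sum]
      refine Finset.sum_congr rfl fun l hl => ?_
      rw [← mul_smul_comm, ← setAverage_eq, h1 l hl, mul_one]
    exact_mod_cast h2
  · have : energyFlux a (box ε L K) w w = ⨍ x in box ε L K,
        conj (∑ l ∈ F, α l * U l x) * ∑ l ∈ F, α l * ((a x : ℂ) * D l x) := by
      refine average_congr ?_
      filter_upwards [hww', hwG] with x hx hx'
      rw [hx, hsum, hx', Prod.fst_sum, Finset.mul_sum]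
      congr 1
      refine Finset.sum_congr rfl fun l _ => ?_
      simp only [Prod.smul_fst, smul_eq_mul, D]
      ring
    rw [this, setAverage_eq, ID, Finset.smul_sum]
    refine Finset.sum_congr rfl fun l hl => ?_
    rw [← mul_smul_comm, ← setAverage_eq, flux l hl _ (isOpen_box ε L K)]
  · intro l hl
    rw [flux l hl _ (isOpen_box ε L K), flux l hl _ (isOpen_cell ε)]
    exact average_box_conj_mul hε hL hK (qU l hl) (qD l hl)
      (integrable_conj_mul (mU l hl) (mD l hl))

/-- By diagonality it suffices to argue mode by mode: `τ |Re b|` uses at most half of `s Im b`, and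
the other half is at least `c₀/2`, because `Im b` is the Poynting number. The sign `s = ±1` treats
both ends of the guide at once. -/
theorem half_mul_average_le_flux (hε : 0 < ε) {L K : ℕ} (hL : 0 < L) (hK : 0 < K)
    {a : ℝ × ℝ → ℝ} (ha : CellPeriodic ε a)
    (ham : AEStronglyMeasurable a (volume.restrict (box ε L K))) {M : ℝ}
    (hM : ∀ᵐ x ∂volume.restrict (box ε L K), |a x| ≤ M) {μ : ℝ × ℝ → ℕ → ℝ}
    (hΨ : IsBlochFamily ε a Ψ μ) {I : Set ((ℝ × ℝ) × ℕ)} (hI : I ⊆ indexSet L K)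
    (hne : ∀ l ∈ I, ∀ l' ∈ I, l ≠ l' → l.1 ≠ l'.1) {s c₀ τ : ℝ} (hs : |s| = 1) (hτ : 0 ≤ τ)
    (hA : ∀ l ∈ I, c₀ ≤ s * poynting ε a Ψ l)
    (hσ : ∀ l ∈ I,
      2 * τ * |(energyFlux a (box ε L K) (blochWave ε Ψ l) (blochWave ε Ψ l)).re| ≤
        s * (energyFlux a (box ε L K) (blochWave ε Ψ l) (blochWave ε Ψ l)).im)
    {w : ℝ × ℝ → ℂ} (hw : w ∈ blochSpan ε L K Ψ I) :
    c₀ / 2 * ⨍ x in box ε L K, ‖w x‖ ^ 2 ≤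
      s * ((energyFlux a (box ε L K) w w).im - τ * (energyFlux a (box ε L K) w w).re) := by
  obtain ⟨F, ρ, hF, hρ, h1, h2, h3⟩ :=
    exists_diagonal_expansion hε hL hK ha ham hM hΨ hI hne hw
  rw [h1, h2, Complex.re_sum, Complex.im_sum, Finset.mul_sum, Finset.mul_sum,
    ← Finset.sum_sub_distrib, Finset.mul_sum]
  refine Finset.sum_le_sum fun l hl => ?_
  have e1 := hA l (hF hl)
  have e2 := hσ l (hF hl)
  rw [poynting, ← h3 l hl] at e1
  set b := energyFlux a (box ε L K) (blochWave ε Ψ l) (blochWave ε Ψ l)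
  rw [Complex.re_ofReal_mul, Complex.im_ofReal_mul]
  have e3 : s * (τ * b.re) ≤ τ * |b.re| := by
    calc s * (τ * b.re) ≤ |s * (τ * b.re)| := le_abs_self _
      _ = τ * |b.re| := by rw [abs_mul, hs, one_mul, abs_mul, abs_of_nonneg hτ]
  nlinarith [mul_le_mul_of_nonneg_left (show c₀ / 2 ≤ s * b.im - s * (τ * b.re) by linarith) (hρ l)]


/-! ### Transport to the radiation boxes -/

theorem CellPeriodic.add_int_mul {a : ℝ × ℝ → ℝ} (ha : CellPeriodic ε a) (n : ℤ) (x : ℝ × ℝ) :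
    a (x + (n * ε, 0)) = a x := by
  have h : Function.Periodic (fun s => a (s, x.2)) ε := fun s => (ha (s, x.2)).1
  have := h.int_mul n x.1
  simpa [Prod.add_def] using this

theorem blochWave_mem_blochSpan {L K : ℕ} {Ψ : ℝ × ℝ → ℕ → ℝ × ℝ → ℂ} {I : Set ((ℝ × ℝ) × ℕ)}
    {l : (ℝ × ℝ) × ℕ} (hl : l ∈ I) : blochWave ε Ψ l ∈ blochSpan ε L K Ψ I :=
  ⟨_, Submodule.subset_span ⟨l, hl, rfl⟩, Filter.EventuallyEq.rfl⟩

/-- The shift is by a whole number of periods, so on `B` the medium becomes the periodic coefficient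
`b` on the reference box. Multiplying by the area of the box turns averages into integrals. -/
theorem flux_and_regularity_of_shift (hε : 0 < ε) {L K : ℕ} (hL : 0 < L) (hK : 0 < K)
    {a b : ℝ × ℝ → ℝ} (hb : CellPeriodic ε b) {n : ℤ} {S B : Set (ℝ × ℝ)} (hS : IsOpen S)
    (hBS : B ⊆ S) (hB : (· + ((n * ε, 0) : ℝ × ℝ)) ⁻¹' B = box ε L K)
    (ham : AEStronglyMeasurable a (volume.restrict B)) {M : ℝ}
    (hM : ∀ᵐ x ∂volume.restrict B, |a x| ≤ M) (hab : a =ᵐ[volume.restrict B] b)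
    {Ψ : ℝ × ℝ → ℕ → ℝ × ℝ → ℂ} {μ : ℝ × ℝ → ℕ → ℝ} (hΨ : IsBlochFamily ε b Ψ μ)
    {I : Set ((ℝ × ℝ) × ℕ)} (hI : I ⊆ indexSet L K)
    (hne : ∀ l ∈ I, ∀ l' ∈ I, l ≠ l' → l.1 ≠ l'.1) {s c₀ C₀ τ : ℝ} (hs : |s| = 1) (hτ : 0 ≤ τ)
    (hA : ∀ l ∈ indexSet L K, blochWave ε Ψ l ∈ blochSpan ε L K Ψ I → c₀ ≤ s * poynting ε b Ψ l)
    (hreg : ∀ w ∈ blochSpan ε L K Ψ I,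
      h1NormSq (box ε L K) (box ε L K) w ≤ C₀ * l2NormSq (box ε L K) w)
    (hσ : ∀ l ∈ indexSet L K, blochWave ε Ψ l ∈ blochSpan ε L K Ψ I →
      2 * τ * |(energyFlux b (box ε L K) (blochWave ε Ψ l) (blochWave ε Ψ l)).re| ≤
        s * (energyFlux b (box ε L K) (blochWave ε Ψ l) (blochWave ε Ψ l)).im)
    {u : ℝ × ℝ → ℂ} {g : ℝ × ℝ → ℂ × ℂ} (hg : HasWeakGradOn S u g)
    (hw : (fun x => u (x + (n * ε, 0))) ∈ blochSpan ε L K Ψ I) :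
    c₀ / 2 * l2NormSq B u ≤ s * ((∫ x in B, conj (u x) * ((a x : ℂ) * (g x).1)).im -
        τ * (∫ x in B, conj (u x) * ((a x : ℂ) * (g x).1)).re) ∧
      h1NormSq S B u ≤ C₀ * l2NormSq B u := by
  set T : ℝ × ℝ := (n * ε, 0)
  have mp : MeasurePreserving (fun x : ℝ × ℝ => x + T) volume volume :=
    measurePreserving_add_right volume T
  have me : MeasurableEmbedding (fun x : ℝ × ℝ => x + T) := measurableEmbedding_addRight T
  have rmp := mp.restrict_preimage_emb me B
  rw [hB] at rmp
  have hbT : ∀ᵐ x ∂volume.restrict (box ε L K), a (x + T) = b x := by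
    filter_upwards [rmp.quasiMeasurePreserving.ae hab] with x hx
    rw [hx, hb.add_int_mul]
  -- `b` is only assumed periodic; its measurability and its bound are inherited from `a` through
  -- the shift.
  have hbm : AEStronglyMeasurable b (volume.restrict (box ε L K)) :=
    (ham.comp_measurePreserving rmp).congr hbT
  have hbM : ∀ᵐ x ∂volume.restrict (box ε L K), |b x| ≤ M := by
    filter_upwards [hbT, rmp.quasiMeasurePreserving.ae hM] with x hx hx'
    rwa [← hx]
  have hsub : box ε L K ⊆ (· + T) ⁻¹' S := hB ▸ preimage_mono hBS
  have hgS : weakGrad S u =ᵐ[volume.restrict B] g :=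
    ae_mono (Measure.restrict_mono hBS le_rfl) (hg.weakGrad_ae_eq hS)
  have hwg := ((hg.comp_add_right T).mono hsub).weakGrad_ae_eq (isOpen_box ε L K)
  have hl2 : l2NormSq (box ε L K) (fun x => u (x + T)) = l2NormSq B u := by
    rw [l2NormSq, l2NormSq, ← mp.setIntegral_preimage_emb me _ B, hB]
  have hh1 : h1NormSq (box ε L K) (box ε L K) (fun x => u (x + T)) = h1NormSq S B u := by
    rw [h1NormSq, h1NormSq, hl2, ← mp.setIntegral_preimage_emb me _ B, hB]
    congr 1
    refine integral_congr_ae ?_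
    filter_upwards [hwg, rmp.quasiMeasurePreserving.ae hgS] with x hx hx'
    rw [hx, hx']
  have hflux : energyFlux b (box ε L K) (fun x => u (x + T)) (fun x => u (x + T)) =
      (((ε * L * (ε * K))⁻¹ : ℝ) : ℂ) * ∫ x in B, conj (u x) * ((a x : ℂ) * (g x).1) := by
    rw [energyFlux, setAverage_eq, volume_real_box hε, ← mp.setIntegral_preimage_emb me _ B, hB,
      Complex.real_smul]
    congr 1
    refine integral_congr_ae ?_
    filter_upwards [hwg, hbT] with x hx hx'
    rw [hx, hx']
  refine ⟨?_, by rw [← hh1, ← hl2]; exact hreg _ hw⟩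
  have key := half_mul_average_le_flux hε hL hK hb hbm hbM hΨ hI hne hs hτ
    (fun l hl => hA l (hI hl) (blochWave_mem_blochSpan hl))
    (fun l hl => hσ l (hI hl) (blochWave_mem_blochSpan hl)) hw
  rw [hflux, setAverage_eq, volume_real_box hε, Complex.re_ofReal_mul, Complex.im_ofReal_mul,
    smul_eq_mul] at key
  change c₀ / 2 * ((ε * L * (ε * K))⁻¹ * l2NormSq (box ε L K) (fun x => u (x + T))) ≤ _ at key
  rw [hl2] at key
  have hL' : (0 : ℝ) < L := by exact_mod_cast hL
  have hK' : (0 : ℝ) < K := by exact_mod_cast hK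
  have hp : 0 < (ε * L * (ε * K))⁻¹ := by positivity
  refine le_of_mul_le_mul_left ?_ hp
  calc _ = c₀ / 2 * ((ε * L * (ε * K))⁻¹ * l2NormSq B u) := by ring
    _ ≤ _ := key
    _ = _ := by ring

/-! ### Decomposition of the truncated guide -/

theorem isOpen_unrolled (ε : ℝ) (N : ℕ) : IsOpen (unrolled ε N) := isOpen_Ioo.prod isOpen_univ

theorem measurableSet_trunc (ε : ℝ) (N K : ℕ) : MeasurableSet (trunc ε N K) :=
  measurableSet_Ioo.prod measurableSet_Ioo

theorem trunc_subset_guide (ε : ℝ) (N K : ℕ) : trunc ε N K ⊆ guide ε K :=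
  prod_mono (subset_univ _) subset_rfl

theorem trunc_subset_unrolled (ε : ℝ) (N K : ℕ) : trunc ε N K ⊆ unrolled ε N :=
  prod_mono subset_rfl (subset_univ _)

theorem trunc_subset_trunc (hε : 0 < ε) (R L K : ℕ) : trunc ε R K ⊆ trunc ε (R + L) K := by
  have h : ε * R ≤ ε * (R + L : ℕ) := by push_cast; nlinarith [Nat.cast_nonneg (α := ℝ) L]
  exact prod_mono (Ioo_subset_Ioo (by linarith) h) subset_rfl

theorem boxRight_subset_trunc (hε : 0 < ε) (R L K : ℕ) : boxRight ε R L K ⊆ trunc ε (R + L) K := by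
  refine prod_mono (Ioo_subset_Ioo ?_ (by push_cast; rfl)) subset_rfl
  have : 0 ≤ ε * R := by positivity
  have : 0 ≤ ε * (R + L : ℕ) := by positivity
  linarith

theorem boxLeft_subset_trunc (hε : 0 < ε) (R L K : ℕ) : boxLeft ε R L K ⊆ trunc ε (R + L) K := by
  refine prod_mono (Ioo_subset_Ioo (by push_cast; rfl) ?_) subset_rfl
  have : 0 ≤ ε * R := by positivity
  have : 0 ≤ ε * (R + L : ℕ) := by positivity
  linarith

theorem trunc_ae_eq_union (hε : 0 < ε) (R L K : ℕ) :
    trunc ε (R + L) K =ᵐ[volume]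
      (trunc ε R K ∪ (boxRight ε R L K ∪ boxLeft ε R L K) : Set (ℝ × ℝ)) := by
  have hline : ∀ c : ℝ, ∀ᵐ x : ℝ × ℝ, x.1 ≠ c := fun c => by
    have h := Measure.quasiMeasurePreserving_fst (μ := (volume : Measure ℝ))
      (ν := (volume : Measure ℝ))
    exact h.ae (Measure.ae_ne volume c)
  filter_upwards [hline (ε * R), hline (-(ε * R))] with x h1 h2
  refine propext ⟨fun hx => ?_, fun hx => ?_⟩
  · obtain ⟨⟨hx1, hx2⟩, hy⟩ := hx
    push_cast at hx1 hx2
    rcases lt_or_gt_of_ne h1 with h | h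
    · rcases lt_or_gt_of_ne h2 with h' | h'
      · exact Or.inr (Or.inr ⟨⟨hx1, h'⟩, hy⟩)
      · exact Or.inl ⟨⟨h', h⟩, hy⟩
    · exact Or.inr (Or.inl ⟨⟨h, hx2⟩, hy⟩)
  · rcases hx with hx | hx | hx
    · exact trunc_subset_trunc hε R L K hx
    · exact boxRight_subset_trunc hε R L K hx
    · exact boxLeft_subset_trunc hε R L K hx

theorem setIntegral_trunc (hε : 0 < ε) (R L K : ℕ) {f : ℝ × ℝ → ℝ}
    (hf : IntegrableOn f (trunc ε (R + L) K)) :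
    ∫ x in trunc ε (R + L) K, f x = (∫ x in trunc ε R K, f x) +
      ((∫ x in boxRight ε R L K, f x) + ∫ x in boxLeft ε R L K, f x) := by
  have hR : 0 ≤ ε * R := by positivity
  have m1 : MeasurableSet (boxRight ε R L K) := measurableSet_Ioo.prod measurableSet_Ioo
  have m2 : MeasurableSet (boxLeft ε R L K) := measurableSet_Ioo.prod measurableSet_Ioo
  have i0 := hf.mono_set (trunc_subset_trunc hε R L K)
  have i1 := hf.mono_set (boxRight_subset_trunc hε R L K)
  have i2 := hf.mono_set (boxLeft_subset_trunc hε R L K)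
  rw [setIntegral_congr_set (trunc_ae_eq_union hε R L K), setIntegral_union ?_ (m1.union m2) i0
    (i1.union i2), setIntegral_union ?_ m2 i1 i2]
  · rw [disjoint_left]
    rintro x ⟨⟨h1, -⟩, -⟩ ⟨⟨-, h2⟩, -⟩
    linarith
  · rw [disjoint_left]
    rintro x ⟨⟨h1, h2⟩, -⟩ (⟨⟨h3, -⟩, -⟩ | ⟨⟨-, h4⟩, -⟩) <;> linarith

theorem cutoff_nonneg (hε : 0 < ε) (R L : ℕ) (ξ : ℝ) : 0 ≤ cutoff ε R L ξ := by
  unfold cutoff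
  split_ifs with h1 h2
  · exact le_rfl
  · exact zero_le_one
  · exact div_nonneg (by linarith) (by positivity)

theorem cutoff_le_one (hε : 0 < ε) (R : ℕ) {L : ℕ} (hL : 0 < L) (ξ : ℝ) : cutoff ε R L ξ ≤ 1 := by
  have hL' : (0 : ℝ) < L := by exact_mod_cast hL
  unfold cutoff
  split_ifs with h1 h2
  · exact zero_le_one
  · exact le_rfl
  · rw [div_le_one (by positivity)]
    linarith

theorem cutoff_eq_one (hε : 0 < ε) {R L K : ℕ} (hL : 0 < L) {x : ℝ × ℝ} (hx : x ∈ trunc ε R K) :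
    cutoff ε R L x.1 = 1 := by
  have hL' : (0 : ℝ) < L := by exact_mod_cast hL
  have h : |x.1| < ε * R := abs_lt.2 hx.1
  unfold cutoff
  rw [if_neg (by nlinarith [mul_pos hε hL']), if_pos h.le]

theorem measurable_cutoff (ε : ℝ) (R L : ℕ) : Measurable (cutoff ε R L) := by
  unfold cutoff
  refine Measurable.ite (measurableSet_le measurable_const measurable_norm) measurable_const
    (Measurable.ite (measurableSet_le measurable_norm measurable_const) measurable_const ?_)
  exact (measurable_const.sub measurable_norm).div_const _

theorem integrable_mul_cutoff (hε : 0 < ε) (R : ℕ) {L : ℕ} (hL : 0 < L) {μ : Measure (ℝ × ℝ)}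
    {f : ℝ × ℝ → ℝ} (hf : Integrable f μ) : Integrable (fun x => f x * cutoff ε R L x.1) μ := by
  refine hf.mul_bdd (c := 1)
    ((measurable_cutoff ε R L).comp measurable_fst).aestronglyMeasurable (ae_of_all _ fun x => ?_)
  rw [Real.norm_of_nonneg (cutoff_nonneg hε R L _)]
  exact cutoff_le_one hε R hL _

/-- The cutoff is one on `Ω_R`, and the nonnegative contribution of the boxes is dropped. For the
Dirichlet energy this loses nothing essential: (A3) recovers the gradient in the boxes. -/
theorem setIntegral_trunc_le_mul_cutoff (hε : 0 < ε) {R L K : ℕ} (hL : 0 < L) {f : ℝ × ℝ → ℝ}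
    (h0 : ∀ᵐ x ∂volume.restrict (trunc ε (R + L) K), 0 ≤ f x)
    (hf : IntegrableOn f (trunc ε (R + L) K)) :
    ∫ x in trunc ε R K, f x ≤ ∫ x in trunc ε (R + L) K, f x * cutoff ε R L x.1 := by
  have hi := integrable_mul_cutoff hε R hL hf
  calc ∫ x in trunc ε R K, f x = ∫ x in trunc ε R K, f x * cutoff ε R L x.1 := by
        refine setIntegral_congr_fun (measurableSet_trunc ε R K) fun x hx => ?_
        simp only [cutoff_eq_one hε hL hx, mul_one]
    _ ≤ _ := by
        refine setIntegral_mono_set hi ?_ (trunc_subset_trunc hε R L K).eventuallyLE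
        filter_upwards [h0] with x hx
        exact mul_nonneg hx (cutoff_nonneg hε R L _)

theorem setIntegral_mul_cutoff_le (hε : 0 < ε) {R L K : ℕ} (hL : 0 < L) {f : ℝ × ℝ → ℝ}
    (h0 : ∀ x, 0 ≤ f x) (hf : IntegrableOn f (trunc ε (R + L) K)) :
    ∫ x in trunc ε (R + L) K, f x * cutoff ε R L x.1 ≤ ∫ x in trunc ε (R + L) K, f x :=
  integral_mono (integrable_mul_cutoff hε R hL hf) hf fun x =>
    mul_le_of_le_one_right (h0 x) (cutoff_le_one hε R hL _)

/-! ### Real and imaginary part of the form -/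

theorem beta_self_eq (hε : 0 < ε) (ω δ : ℝ) (R : ℕ) {L : ℕ} (hL : 0 < L) (K : ℕ) (a : ℝ × ℝ → ℝ)
    {u : ℝ × ℝ → ℂ} (hu : MemLp u 2 (volume.restrict (trunc ε (R + L) K))) :
    let g := weakGrad (unrolled ε (R + L)) u
    let Jr := ∫ x in boxRight ε R L K, conj (u x) * ((a x : ℂ) * (g x).1)
    let Jl := ∫ x in boxLeft ε R L K, conj (u x) * ((a x : ℂ) * (g x).1)
    (beta ε ω δ R L K a u u).re =
        (∫ x in trunc ε (R + L) K, a x * (‖(g x).1‖ ^ 2 + ‖(g x).2‖ ^ 2) * cutoff ε R L x.1) -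
          ω ^ 2 * (∫ x in trunc ε (R + L) K, ‖u x‖ ^ 2 * cutoff ε R L x.1) -
          1 / (ε * L) * Jr.re + 1 / (ε * L) * Jl.re ∧
      (beta ε ω δ R L K a u u).im =
        δ * ω ^ 2 * l2NormSq (trunc ε R K) u + 1 / (ε * L) * Jr.im - 1 / (ε * L) * Jl.im := by
  classical
  intro g Jr Jl
  have hq : IntegrableOn (fun x => ‖u x‖ ^ 2) (trunc ε (R + L) K) :=
    (memLp_two_iff_integrable_sq_norm hu.1).1 hu
  have hqc := integrable_mul_cutoff hε R hL hq
  have t1 : (∫ x in trunc ε (R + L) K, (a x : ℂ) *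
      (conj (g x).1 * (g x).1 + conj (g x).2 * (g x).2) * (cutoff ε R L x.1 : ℂ)) =
      ((∫ x in trunc ε (R + L) K,
        a x * (‖(g x).1‖ ^ 2 + ‖(g x).2‖ ^ 2) * cutoff ε R L x.1 : ℝ) : ℂ) := by
    rw [← integral_complex_ofReal]
    congr 1
    ext x
    rw [Complex.conj_mul', Complex.conj_mul']
    push_cast
    rfl
  have hin : IntegrableOn (fun x => (trunc ε R K).indicator
      (fun x => ‖u x‖ ^ 2 * cutoff ε R L x.1) x) (trunc ε (R + L) K) :=
    hqc.indicator (measurableSet_trunc ε R K)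
  have ein : ∫ x in trunc ε (R + L) K, (trunc ε R K).indicator
      (fun x => ‖u x‖ ^ 2 * cutoff ε R L x.1) x = l2NormSq (trunc ε R K) u := by
    rw [setIntegral_indicator (measurableSet_trunc ε R K),
      inter_eq_self_of_subset_right (trunc_subset_trunc hε R L K)]
    refine setIntegral_congr_fun (measurableSet_trunc ε R K) fun x hx => ?_
    simp only [cutoff_eq_one hε hL hx, mul_one]
  have t2 : (∫ x in trunc ε (R + L) K,
      (1 - Complex.I * δ * (if x ∈ trunc ε R K then 1 else 0)) * (ω : ℂ) ^ 2 *
        conj (u x) * u x * (cutoff ε R L x.1 : ℂ)) =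
      (ω : ℂ) ^ 2 * ((∫ x in trunc ε (R + L) K, ‖u x‖ ^ 2 * cutoff ε R L x.1 : ℝ) : ℂ) -
        Complex.I * δ * (ω : ℂ) ^ 2 * (l2NormSq (trunc ε R K) u : ℂ) := by
    rw [← ein, ← integral_complex_ofReal, ← integral_complex_ofReal, ← integral_const_mul,
      ← integral_const_mul, ← integral_sub (hqc.ofReal.const_mul _) (hin.ofReal.const_mul _)]
    congr 1
    ext x
    have : (1 - Complex.I * δ * (if x ∈ trunc ε R K then 1 else 0)) * (ω : ℂ) ^ 2 *
        conj (u x) * u x * (cutoff ε R L x.1 : ℂ) =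
        (1 - Complex.I * δ * (if x ∈ trunc ε R K then 1 else 0)) * (ω : ℂ) ^ 2 *
        (conj (u x) * u x) * (cutoff ε R L x.1 : ℂ) := by ring
    rw [this, Complex.conj_mul', indicator_apply]
    split_ifs <;> push_cast <;> ring
  -- In `β` the conjugate falls on the gradient, so its box terms are conjugates of the fluxes. This
  -- reverses the sign of their imaginary parts but not of their real parts.
  have tJ : ∀ B : Set (ℝ × ℝ), ∫ x in B, (a x : ℂ) * conj (g x).1 * u x =
      conj (∫ x in B, conj (u x) * ((a x : ℂ) * (g x).1)) := fun B => by
    rw [← integral_conj]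
    congr 1
    ext x
    simp only [map_mul, Complex.conj_conj, Complex.conj_ofReal]
    ring
  have hk : (1 : ℂ) / ((ε : ℂ) * L) = ((1 / (ε * L) : ℝ) : ℂ) := by push_cast; rfl
  have hb : beta ε ω δ R L K a u u =
      ((∫ x in trunc ε (R + L) K,
        a x * (‖(g x).1‖ ^ 2 + ‖(g x).2‖ ^ 2) * cutoff ε R L x.1 : ℝ) : ℂ) -
      ((ω : ℂ) ^ 2 * ((∫ x in trunc ε (R + L) K, ‖u x‖ ^ 2 * cutoff ε R L x.1 : ℝ) : ℂ) -
        Complex.I * δ * (ω : ℂ) ^ 2 * (l2NormSq (trunc ε R K) u : ℂ)) -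
      ((1 / (ε * L) : ℝ) : ℂ) * conj Jr + ((1 / (ε * L) : ℝ) : ℂ) * conj Jl := by
    rw [← t1, ← t2, ← hk, ← tJ, ← tJ]
    rfl
  rw [hb]
  have ho : (ω : ℂ) ^ 2 = ((ω ^ 2 : ℝ) : ℂ) := by push_cast; rfl
  rw [ho]
  generalize (∫ x in trunc ε (R + L) K,
        a x * (‖(g x).1‖ ^ 2 + ‖(g x).2‖ ^ 2) * cutoff ε R L x.1) = A
  generalize (∫ x in trunc ε (R + L) K, ‖u x‖ ^ 2 * cutoff ε R L x.1) = Q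
  generalize 1 / (ε * L) = κ
  constructor
  · simp [-Complex.ofReal_pow]
  · simp [-Complex.ofReal_pow]
    ring

end Waveguide

end

/-! ### Coercivity: assembling the estimates -/

open Waveguide
theorem mainTheorem2
    (ε ω δ a₀ c₀ C₀ σ : ℝ) (L : ℕ)
    (hε : 0 < ε) (hω : 0 < ω) (hδ : 0 < δ) (ha₀ : 0 < a₀) (hc₀ : 0 < c₀) (hC₀ : 0 < C₀)
    (hσ : 0 < σ) (hL : 0 < L)
    (hσ_le : σ ≤ min (1 / 2) (c₀ / (4 * ε * L * δ * ω ^ 2))) :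
    ∃ γ : ℝ, 0 < γ ∧
      ∀ (R K : ℕ) (_ : 0 < R) (_ : 0 < K)
        (a ap am : ℝ × ℝ → ℝ) (_ : IsMedium ε R K a₀ a ap am)
        (Ψp Ψm : ℝ × ℝ → ℕ → ℝ × ℝ → ℂ) (μp μm : ℝ × ℝ → ℕ → ℝ)
        (_ : IsBlochFamily ε ap Ψp μp) (_ : IsBlochFamily ε am Ψm μm)
        (Ip Im : Set ((ℝ × ℝ) × ℕ)) (_ : Ip ⊆ indexSet L K) (_ : Im ⊆ indexSet L K)
        -- (A1) positive speed
        (_ : ∀ l ∈ indexSet L K, blochWave ε Ψp l ∈ blochSpan ε L K Ψp Ip →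
          c₀ ≤ poynting ε ap Ψp l)
        (_ : ∀ l ∈ indexSet L K, blochWave ε Ψm l ∈ blochSpan ε L K Ψm Im →
          c₀ ≤ -poynting ε am Ψm l)
        -- (A2) different wave numbers
        (_ : ∀ l ∈ Ip, ∀ l' ∈ Ip, l ≠ l' → l.1 ≠ l'.1)
        (_ : ∀ l ∈ Im, ∀ l' ∈ Im, l ≠ l' → l.1 ≠ l'.1)
        -- (A3) regularity
        (_ : ∀ w ∈ blochSpan ε L K Ψp Ip,
          h1NormSq (box ε L K) (box ε L K) w ≤ C₀ * l2NormSq (box ε L K) w)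
        (_ : ∀ w ∈ blochSpan ε L K Ψm Im,
          h1NormSq (box ε L K) (box ε L K) w ≤ C₀ * l2NormSq (box ε L K) w)
        -- smallness of `σ` relative to the energy fluxes
        (_ : ∀ l ∈ indexSet L K, blochWave ε Ψp l ∈ blochSpan ε L K Ψp Ip →
          2 * σ * δ * |(energyFlux ap (box ε L K) (blochWave ε Ψp l) (blochWave ε Ψp l)).re| ≤
            (energyFlux ap (box ε L K) (blochWave ε Ψp l) (blochWave ε Ψp l)).im)
        (_ : ∀ l ∈ indexSet L K, blochWave ε Ψm l ∈ blochSpan ε L K Ψm Im →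
          2 * σ * δ * |(energyFlux am (box ε L K) (blochWave ε Ψm l) (blochWave ε Ψm l)).re| ≤
            -(energyFlux am (box ε L K) (blochWave ε Ψm l) (blochWave ε Ψm l)).im),
        ∀ u ∈ spaceV ε R L K (blochSpan ε L K Ψp Ip) (blochSpan ε L K Ψm Im),
          γ * h1NormSq (unrolled ε (R + L)) (trunc ε (R + L) K) u ≤
            (beta ε ω δ R L K a u u).im + σ * δ * (beta ε ω δ R L K a u u).re := by
  have hL' : (0 : ℝ) < L := by exact_mod_cast hL
  -- The three entries serve the mass on `Ω_R`, the gradient on `Ω_R` and the `H¹` norm on the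
  -- radiation boxes. The choice precedes the medium, `R` and `K`.
  refine ⟨min (δ * ω ^ 2 / 2) (min (σ * δ * a₀) (c₀ / (4 * ε * L * C₀))), by positivity, ?_⟩
  intro R K hR hK a ap am hmed Ψp Ψm μp μm hΨp hΨm Ip Im hIp hIm hAp hAm hnp hnm hrp hrm hsp hsm u hu
  obtain ⟨-, ⟨hu2, g₀, hg₀, hg₀2⟩, hur, hul⟩ := hu
  set S := unrolled ε (R + L)
  set N := trunc ε (R + L) K
  have hS : IsOpen S := isOpen_unrolled ε (R + L)
  have hNS : N ⊆ S := trunc_subset_unrolled ε (R + L) K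
  have hNG : N ⊆ guide ε K := trunc_subset_guide ε (R + L) K
  set g := weakGrad S u
  have hg : HasWeakGradOn S u g := hg₀.weakGrad
  have hgg₀ : g =ᵐ[volume.restrict N] g₀ :=
    ae_mono (Measure.restrict_mono hNS le_rfl) (hg₀.weakGrad_ae_eq hS)
  have hg2 : MemLp g 2 (volume.restrict N) := hg₀2.ae_eq hgg₀.symm
  have toN : ∀ {P : ℝ × ℝ → Prop}, (∀ᵐ x ∂volume.restrict (guide ε K), P x) →
      ∀ᵐ x ∂volume.restrict N, P x := fun h => ae_mono (Measure.restrict_mono hNG le_rfl) h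
  have ham : AEStronglyMeasurable a (volume.restrict N) := hmed.measurable.mono_set hNG
  obtain ⟨M, hM⟩ := hmed.bounded
  have haM : ∀ᵐ x ∂volume.restrict N, |a x| ≤ M := by
    filter_upwards [toN hM, toN hmed.lower] with x h1 h2
    rwa [abs_of_nonneg (ha₀.le.trans h2)]
  have hPN := boxRight_subset_trunc hε R L K
  have hMN := boxLeft_subset_trunc hε R L K
  have hR' : (0 : ℝ) < ε * R := mul_pos hε (by exact_mod_cast hR)
  have hτ : 0 ≤ σ * δ := by positivity
  have right := flux_and_regularity_of_shift (n := R) (B := boxRight ε R L K) (s := 1) hε hL hK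
    hmed.periodic_right hS (hPN.trans hNS)
    (by
      ext x
      simp only [boxRight, box, mem_preimage, mem_prod, mem_Ioo, Prod.fst_add, Prod.snd_add,
        add_zero, Int.cast_natCast]
      constructor <;> rintro ⟨⟨h1, h2⟩, h3⟩ <;> exact ⟨⟨by linarith, by linarith⟩, h3⟩)
    (ham.mono_set hPN) (ae_mono (Measure.restrict_mono hPN le_rfl) haM)
    (by
      filter_upwards [ae_mono (Measure.restrict_mono (hPN.trans hNG) le_rfl) hmed.eq_right,
        ae_restrict_mem (measurableSet_Ioo.prod measurableSet_Ioo)] with x h1 h2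
      exact h1 (by linarith [h2.1.1]))
    hΨp hIp hnp (by simp) hτ (by simpa using hAp) hrp
    (by simpa [mul_assoc] using hsp) hg
    (by
      convert hur using 1
      ext x
      simp [shiftRight, mul_comm, add_comm, Prod.add_def])
  -- Outgoing waves on the left carry negative flux, hence `s = -1`; the left box begins `R + L`
  -- periods left of the origin.
  have left := flux_and_regularity_of_shift (n := -(R + L : ℕ)) (B := boxLeft ε R L K) (s := -1)
    hε hL hK hmed.periodic_left hS (hMN.trans hNS)
    (by
      ext x
      simp only [boxLeft, box, mem_preimage, mem_prod, mem_Ioo, Prod.fst_add, Prod.snd_add,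
        add_zero]
      push_cast
      constructor <;> rintro ⟨⟨h1, h2⟩, h3⟩ <;> exact ⟨⟨by linarith, by linarith⟩, h3⟩)
    (ham.mono_set hMN) (ae_mono (Measure.restrict_mono hMN le_rfl) haM)
    (by
      filter_upwards [ae_mono (Measure.restrict_mono (hMN.trans hNG) le_rfl) hmed.eq_left,
        ae_restrict_mem (measurableSet_Ioo.prod measurableSet_Ioo)] with x h1 h2
      exact h1 (by linarith [h2.1.2]))
    hΨm hIm hnm (by simp) hτ (by simpa using hAm) hrm
    (by simpa [mul_assoc] using hsm) hg
    (by
      convert hul using 1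
      ext x
      simp only [shiftLeft, Prod.add_def]
      push_cast
      congr 2 <;> ring)
  obtain ⟨hre, him⟩ := beta_self_eq hε ω δ R hL K a hu2
  rw [hre, him]
  have iq : IntegrableOn (fun x => ‖u x‖ ^ 2) N := (memLp_two_iff_integrable_sq_norm hu2.1).1 hu2
  have ip : IntegrableOn (fun x => ‖(g x).1‖ ^ 2 + ‖(g x).2‖ ^ 2) N :=
    ((memLp_two_iff_integrable_sq_norm hg2.fst.1).1 hg2.fst).add
      ((memLp_two_iff_integrable_sq_norm hg2.snd.1).1 hg2.snd)
  have iap : IntegrableOn (fun x => a x * (‖(g x).1‖ ^ 2 + ‖(g x).2‖ ^ 2)) N :=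
    ip.bdd_mul ham haM
  have hgrad : a₀ * (∫ x in trunc ε R K, (‖(g x).1‖ ^ 2 + ‖(g x).2‖ ^ 2)) ≤
      ∫ x in N, a x * (‖(g x).1‖ ^ 2 + ‖(g x).2‖ ^ 2) * cutoff ε R L x.1 := by
    refine le_trans ?_ (setIntegral_trunc_le_mul_cutoff hε hL ?_ iap)
    · rw [← integral_const_mul]
      have hRN := trunc_subset_trunc hε R L K
      refine integral_mono_ae ((ip.mono_set hRN).const_mul a₀) (iap.mono_set hRN) ?_
      filter_upwards [ae_mono (Measure.restrict_mono (hRN.trans hNG) le_rfl) hmed.lower] with x hx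
      exact mul_le_mul_of_nonneg_right hx (by positivity)
    · filter_upwards [toN hmed.lower] with x hx
      exact mul_nonneg (ha₀.le.trans hx) (by positivity)
  have hmass := setIntegral_mul_cutoff_le hε hL (R := R) (K := K) (fun x => sq_nonneg ‖u x‖) iq
  rw [setIntegral_trunc hε R L K iq] at hmass
  have hnorm : h1NormSq S N u = l2NormSq (trunc ε R K) u +
      (∫ x in trunc ε R K, (‖(g x).1‖ ^ 2 + ‖(g x).2‖ ^ 2)) +
      (h1NormSq S (boxRight ε R L K) u + h1NormSq S (boxLeft ε R L K) u) := by
    simp only [h1NormSq, l2NormSq]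
    rw [setIntegral_trunc hε R L K iq, setIntegral_trunc hε R L K ip]
    ring
  rw [hnorm]
  have nn : ∀ B : Set (ℝ × ℝ), 0 ≤ l2NormSq B u := fun B => integral_nonneg fun x => sq_nonneg _
  have nC := nn (trunc ε R K)
  have nP := nn (boxRight ε R L K)
  have nM := nn (boxLeft ε R L K)
  have npC : 0 ≤ ∫ x in trunc ε R K, (‖(g x).1‖ ^ 2 + ‖(g x).2‖ ^ 2) :=
    integral_nonneg fun x => by positivity
  change _ ≤ l2NormSq (trunc ε R K) u +
    (l2NormSq (boxRight ε R L K) u + l2NormSq (boxLeft ε R L K) u) at hmass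
  obtain ⟨r1, r2⟩ := right
  obtain ⟨l1, l2⟩ := left
  have hσ1 : σ ≤ 1 / 2 := hσ_le.trans (min_le_left _ _)
  -- The second bound on `σ`: the mass lost in a box is at most half of what its flux yields.
  have hσ2 : σ * δ * ω ^ 2 ≤ c₀ / (4 * ε * L) := by
    have h := hσ_le.trans (min_le_right _ _)
    rw [le_div_iff₀ (by positivity)] at h ⊢
    linarith
  set γ := min (δ * ω ^ 2 / 2) (min (σ * δ * a₀) (c₀ / (4 * ε * L * C₀)))
  have γ0 : 0 ≤ γ := by positivity
  have γ1 : γ ≤ δ * ω ^ 2 / 2 := min_le_left _ _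
  have γ2 : γ ≤ σ * δ * a₀ := (min_le_right _ _).trans (min_le_left _ _)
  have γ3 : γ * C₀ ≤ c₀ / (4 * ε * L) := by
    have h : γ ≤ c₀ / (4 * ε * L * C₀) := (min_le_right _ _).trans (min_le_right _ _)
    rw [le_div_iff₀ (by positivity)] at h ⊢
    linarith
  have hκ : 0 < 1 / (ε * L) := by positivity
  have hκc : 1 / (ε * L) * (c₀ / 2) = 2 * (c₀ / (4 * ε * L)) := by field_simp; norm_num
  have b1 := mul_le_mul_of_nonneg_left r1 hκ.le
  have b2 := mul_le_mul_of_nonneg_left l1 hκ.le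
  rw [← mul_assoc, hκc] at b1 b2
  have b3 := mul_le_mul_of_nonneg_left hgrad hτ
  have b4 := mul_le_mul_of_nonneg_left hmass (show 0 ≤ σ * δ * ω ^ 2 by positivity)
  have b5 := mul_le_mul_of_nonneg_left r2 γ0
  have b6 := mul_le_mul_of_nonneg_left l2 γ0
  have b7 := mul_le_mul_of_nonneg_right γ3 nP
  have b8 := mul_le_mul_of_nonneg_right γ3 nM
  have b9 := mul_le_mul_of_nonneg_right γ1 nC
  have b10 := mul_le_mul_of_nonneg_right γ2 npC
  have b11 := mul_le_mul_of_nonneg_right hσ2 nP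
  have b12 := mul_le_mul_of_nonneg_right hσ2 nM
  have b13 : σ * δ * ω ^ 2 * l2NormSq (trunc ε R K) u ≤
      δ * ω ^ 2 / 2 * l2NormSq (trunc ε R K) u := by
    refine mul_le_mul_of_nonneg_right ?_ nC
    nlinarith [mul_le_mul_of_nonneg_right hσ1 (show 0 ≤ δ * ω ^ 2 by positivity)]
  -- On `Ω_R` the mass coefficient is `δω² - σδω² ≥ δω²/2 ≥ γ` and the gradient coefficient is `σδa₀
  -- ≥ γ`. In each box, `2q - σδω² ≥ q ≥ γC₀` with `q = c₀/(4εL)`.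
  linarith
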